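/- Let $(W,S)$ be a Coxeter system with $S$ finite, with presentation diagram $\Gamma$ (vertex set $S$, an edge between distinct $s,t$ when $m(s,t)<\infty$). For $A\subset S$ let $\langle A\rangle$ be the subgroup generated by $A$; say that $A$ separates $C\subset S$ in $\Gamma$ if there are $c_1,c_2\in C-A$ such that every path in $\Gamma$ from $c_1$ to $c_2$ meets $A$. Graph of groups decompositions are over finite trees (no other graphs occur for Coxeter groups), with vertex and edge groups subgroups of the decomposed group and inclusions as edge maps. Such a decomposition is visual if all vertex and edge groups have the form $\langle A\rangle$ with $A\subset S$; a vertex is then named by the set $A$ that generates its group. It is reduced if no edge group equals the group of an end point of that edge. A decomposition $\Phi$ of a vertex group $\Lambda(v)$ of $\Lambda$ is compatible with $\Lambda$ if the group of each edge of $\Lambda$ at $v$ lies in a $\Lambda(v)$-conjugate of a vertex group of $\Phi$. A splitting of $G$ over $D$ is a decomposition $G=X*_DY$; it is non-trivial if $D\ne X$ and $D\neq Y$. A visual decomposition $\Psi$ of $W$ is JSJ-amenable if it is reduced and, for every vertex $V\subset S$ of $\Psi$ and every $E\subset S$ such that $\langle E\rangle$ is the group of an edge at $V$, no $A\subset V$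 with $\langle A\rangle$ virtually abelian separates $E$ in $\Gamma$. For a vertex $V$ of $\Psi$, let $M(\Psi,\langle V\rangle)$ be the set of virtually abelian subgroups $A$ of $\langle V\rangle$ such that $\langle V\rangle$ splits non-trivially and compatibly with $\Psi$ over $A$, and there is no virtually abelian $B$ such that $\langle V\rangle$ splits non-trivially and compatibly with $\Psi$ over $B$ and $A\cap B$ has infinite index in $A$ and finite index in $B$. A reduced decomposition $\Lambda$ of $\langle V\rangle$ that is compatible with $\Psi$ is weakly $M(\Psi,\langle V\rangle)$-JSJ if all its edge groups are in $M(\Psi,\langle V\rangle)$ and each element of $M(\Psi,\langle V\rangle)$ lies in a $\langle V\rangle$-conjugate of a vertex group of $\Lambda$. It is $M(\Psi,\langle V\rangle)$-JSJ if moreover, whenever a vertex group $U$ of $\Lambda$ is replaced by a non-trivial $\Lambda$-compatible splitting of $U$ over an element of $M(\Psi,\langle V\rangle)$ and the result is reduced (by collapsing edges whose group equals that of an end point), the reduced decomposition so obtained is not weakly $M(\Psi,\langle V\rangle)$-JSJ. Theorem. Let $\Psi$ be a JSJ-amenable visual decomposition of $W$, let $V\subset S$ be a vertex of $\Psi$,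 and let $\Psi_1,\Psi_2$ be visual $M(\Psi,\langle V\rangle)$-JSJ decompositions of $\langle V\rangle$. Then a set $Q\subset V$ is a vertex of $\Psi_1$ if and only if it is a vertex of $\Psi_2$. -/

import Mathlib

namespace CoxeterJSJ

noncomputable section

open Classical

universe u v

/-! ### Trees of groups inside an ambient group -/

/-- The conjugate `g K g⁻¹`. -/
def conjSubgroup {W : Type u} [Group W] (g : W) (K : Subgroup W) : Subgroup W :=
  K.map (MulAut.conj g).toMonoidHom

/-- A subgroup is virtually abelian if it has an abelian subgroup of finite index. -/
def VirtuallyAbelian {W : Type u} [Group W] (A : Subgroup W) : Prop :=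
  ∃ N : Subgroup W, N ≤ A ∧ N.relIndex A ≠ 0 ∧ ∀ x ∈ N, ∀ y ∈ N, x * y = y * x

/-- The data of a graph whose vertices and edges are labelled by subgroups of `W`. The value
`edge x y` is meaningful only if `x` and `y` are adjacent. That the graph is a finite tree, that
edge groups do not depend on the orientation and lie in the groups of their end points, is part
of `IsDecompositionOf` below. Loops and multiple edges are not needed: a decomposition of
a Coxeter group always has a tree as its underlying graph, as such a group has no
non-trivial homomorphism to `ℤ`. -/
structure GraphOfSubgroups (W : Type u) [Group W] where
  ι : Type
  graph : SimpleGraph ι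
  vert : ι → Subgroup W
  edge : ι → ι → Subgroup W

namespace GraphOfSubgroups

variable {W : Type u} [Group W]

/-- The relators identifying the two copies of each edge group in the free product of the vertex
groups. -/
def relators (Λ : GraphOfSubgroups W) : Set (Monoid.CoprodI fun x => Λ.vert x) :=
  {r | ∃ (x y : Λ.ι) (e : W) (hx : e ∈ Λ.vert x) (hy : e ∈ Λ.vert y),
    Λ.graph.Adj x y ∧ e ∈ Λ.edge x y ∧
      r = Monoid.CoprodI.of (M := fun x => Λ.vert x) (i := x) ⟨e, hx⟩ *
        (Monoid.CoprodI.of (M := fun x => Λ.vert x) (i := y) ⟨e, hy⟩)⁻¹}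

/-- The fundamental group of a tree of groups: the free product of the vertex groups amalgamated
along the edge groups. -/
abbrev FundamentalGroup (Λ : GraphOfSubgroups W) : Type u :=
  (Monoid.CoprodI fun x => Λ.vert x) ⧸ Subgroup.normalClosure Λ.relators

/-- The homomorphism from the fundamental group to `W` induced by the inclusions of the vertex
groups. -/
def toAmbient (Λ : GraphOfSubgroups W) : Λ.FundamentalGroup →* W :=
  QuotientGroup.lift (Subgroup.normalClosure Λ.relators)
    (Monoid.CoprodI.lift fun x => (Λ.vert x).subtype)
    (by
      intro r hr
      have h : Subgroup.normalClosure Λ.relators ≤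
          (Monoid.CoprodI.lift fun x => (Λ.vert x).subtype).ker := by
        apply Subgroup.normalClosure_le_normal
        rintro _ ⟨x, y, e, hx, hy, -, -, rfl⟩
        simp [MonoidHom.mem_ker]
      exact h hr)

/-- `Λ` is a (finite tree of groups) decomposition of the subgroup `H` of `W`: the inclusions of
the vertex groups induce an isomorphism of the fundamental group of `Λ` with `H`. -/
structure IsDecompositionOf (Λ : GraphOfSubgroups W) (H : Subgroup W) : Prop where
  finite : Finite Λ.ι
  isTree : Λ.graph.IsTree
  edge_symm : ∀ x y, Λ.graph.Adj x y → Λ.edge x y = Λ.edge y x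
  edge_le : ∀ x y, Λ.graph.Adj x y → Λ.edge x y ≤ Λ.vert x
  injective : Function.Injective Λ.toAmbient
  range_eq : Λ.toAmbient.range = H

/-- No edge group equals the group of an end point of the edge. -/
def IsReduced (Λ : GraphOfSubgroups W) : Prop :=
  ∀ x y, Λ.graph.Adj x y → Λ.edge x y ≠ Λ.vert x ∧ Λ.edge x y ≠ Λ.vert y

/-- A decomposition `Φ` of the vertex group `Λ.vert x` is compatible with `Λ`: every edge group of
an edge of `Λ` at `x` lies in a `Λ.vert x`-conjugate of a vertex group of `Φ`. -/
def CompatibleAt (Λ : GraphOfSubgroups W) (x : Λ.ι) (Φ : GraphOfSubgroups W) : Prop :=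
  ∀ y, Λ.graph.Adj x y →
    ∃ z : Φ.ι, ∃ h ∈ Λ.vert x, Λ.edge x y ≤ conjSubgroup h (Φ.vert z)

/-- The one-edge graph with vertex groups `X` (at `false`), `Y` (at `true`) and edge group `D`.
It is a decomposition of `H` iff `H` is the amalgamated product of `X` and `Y` over `D`. -/
def amalgam (X Y D : Subgroup W) : GraphOfSubgroups W where
  ι := Bool
  graph := ⊤
  vert b := bif b then Y else X
  edge _ _ := D

/-- `X`, `Y`, `D` is a non-trivial splitting of the vertex group `Λ.vert x` as an amalgamated
product of `X` and `Y` over `D` that is compatible with `Λ`. -/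
def IsCompatibleSplitting (Λ : GraphOfSubgroups W) (x : Λ.ι) (X Y D : Subgroup W) : Prop :=
  (amalgam X Y D).IsDecompositionOf (Λ.vert x) ∧ D ≠ X ∧ D ≠ Y ∧
    Λ.CompatibleAt x (amalgam X Y D)

/-- The group at `x` splits non-trivially and compatibly with `Λ` over `D`. -/
def SplitsCompatiblyOver (Λ : GraphOfSubgroups W) (x : Λ.ι) (D : Subgroup W) : Prop :=
  ∃ X Y : Subgroup W, Λ.IsCompatibleSplitting x X Y D

/-- The set of minimal virtually abelian splitting subgroups for `Λ` and its vertex `x`. -/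
def minimalSplitting (Λ : GraphOfSubgroups W) (x : Λ.ι) : Set (Subgroup W) :=
  {A | VirtuallyAbelian A ∧ Λ.SplitsCompatiblyOver x A ∧
    ¬ ∃ B : Subgroup W, VirtuallyAbelian B ∧ Λ.SplitsCompatiblyOver x B ∧
      (B ⊓ A).relIndex A = 0 ∧ (B ⊓ A).relIndex B ≠ 0}

/-! ### Replacing a vertex by a compatible splitting -/

/-- The vertex of `Λ` over which a vertex of a refinement at `u` lies. In the refinement, `u` is
replaced by the two vertices `some u` (with group `X`) and `none` (with group `Y`). -/
def refineProj {ι : Type} (u : ι) : Option ι → ι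
  | none => u
  | some x => x

/-- The vertex of the refinement at which the `x`-end of the edge `xy` of `Λ` is attached. -/
def refineAttach {ι : Type} (u : ι) (side : ι → Bool) (x y : ι) : Option ι :=
  if x = u then (if side y then none else some u) else some x

/-- Replace the vertex `u` of `Λ` by an edge with group `D` and vertex groups `X`, `Y`. The edge
from `u` to a neighbour `y` is attached to `Y` if `side y` is true, and to `X` otherwise; the
vertex and edge groups of the branch of `Λ` at `u` that contains `y` are conjugated by `g y`. -/
def refine (Λ : GraphOfSubgroups W) (u : Λ.ι) (X Y D : Subgroup W)
    (side : Λ.ι → Bool) (g : Λ.ι → W) : GraphOfSubgroups W where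
  ι := Option Λ.ι
  graph := SimpleGraph.fromRel fun p q =>
    (p = some u ∧ q = none) ∨
      (Λ.graph.Adj (refineProj u p) (refineProj u q) ∧
        p = refineAttach u side (refineProj u p) (refineProj u q) ∧
        q = refineAttach u side (refineProj u q) (refineProj u p))
  vert
    | none => Y
    | some x => if x = u then X else conjSubgroup (g x) (Λ.vert x)
  edge p q :=
    if refineProj u p = u then
      if refineProj u q = u then D
      else conjSubgroup (g (refineProj u q)) (Λ.edge (refineProj u p) (refineProj u q))
    else conjSubgroup (g (refineProj u p)) (Λ.edge (refineProj u p) (refineProj u q))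

/-- The choices `side` and `g` are admissible for replacing `u` by `X *_D Y`: `g` takes values
in the group at `u`, is constant on the branches of `Λ` at `u`, and moves the group of
each edge at `u` into the vertex group to which that edge gets attached. -/
structure IsAdmissible (Λ : GraphOfSubgroups W) (u : Λ.ι) (X Y : Subgroup W)
    (side : Λ.ι → Bool) (g : Λ.ι → W) : Prop where
  mem : ∀ y, g y ∈ Λ.vert u
  const : ∀ x y, Λ.graph.Adj x y → x ≠ u → y ≠ u → g x = g y
  edge_le : ∀ y, Λ.graph.Adj u y →
    conjSubgroup (g y) (Λ.edge u y) ≤ if side y then Y else X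

/-! ### Reducing -/

/-- Collapse the edge `ab`, absorbing the vertex `a` into the vertex `b`. -/
def collapse (Λ : GraphOfSubgroups W) (a b : Λ.ι) : GraphOfSubgroups W where
  ι := {x : Λ.ι // x ≠ a}
  graph := SimpleGraph.fromRel fun x y =>
    Λ.graph.Adj x.1 y.1 ∨ (x.1 = b ∧ Λ.graph.Adj a y.1)
  vert x := Λ.vert x.1
  edge x y :=
    if Λ.graph.Adj x.1 y.1 then Λ.edge x.1 y.1
    else if x.1 = b then Λ.edge a y.1
    else Λ.edge x.1 a

/-- `Λ'` arises from `Λ` by collapsing an edge whose group is the group of the end point `a`. -/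
def CollapsesTo (Λ Λ' : GraphOfSubgroups W) : Prop :=
  ∃ a b : Λ.ι, Λ.graph.Adj a b ∧ Λ.edge a b = Λ.vert a ∧ Λ' = Λ.collapse a b

/-- `Λ'` is reduced and arises from `Λ` by finitely many collapses. -/
def ReducesTo (Λ Λ' : GraphOfSubgroups W) : Prop :=
  Relation.ReflTransGen CollapsesTo Λ Λ' ∧ Λ'.IsReduced

/-! ### JSJ decompositions of a vertex group -/

/-- `Λ` is a weakly `M(Ψ, Ψ(x))`-JSJ decomposition of the vertex group `Ψ(x)`. -/
structure IsWeaklyJSJ (Ψ : GraphOfSubgroups W) (x : Ψ.ι) (Λ : GraphOfSubgroups W) : Prop where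
  decomposition : Λ.IsDecompositionOf (Ψ.vert x)
  reduced : Λ.IsReduced
  compatible : Ψ.CompatibleAt x Λ
  edge_mem : ∀ y z, Λ.graph.Adj y z → Λ.edge y z ∈ Ψ.minimalSplitting x
  elliptic : ∀ A ∈ Ψ.minimalSplitting x,
    ∃ z : Λ.ι, ∃ h ∈ Ψ.vert x, A ≤ conjSubgroup h (Λ.vert z)

/-- `Λ` is an `M(Ψ, Ψ(x))`-JSJ decomposition of `Ψ(x)`: it is weakly JSJ, and whenever a vertex
group of `Λ` is replaced by a non-trivial `Λ`-compatible splitting over a member of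
`M(Ψ, Ψ(x))`, the resulting reduced decomposition is not weakly JSJ. -/
structure IsJSJ (Ψ : GraphOfSubgroups W) (x : Ψ.ι) (Λ : GraphOfSubgroups W) : Prop where
  weakly : Ψ.IsWeaklyJSJ x Λ
  maximal : ∀ (u : Λ.ι) (X Y D : Subgroup W), D ∈ Ψ.minimalSplitting x →
    Λ.IsCompatibleSplitting u X Y D →
    ∀ (side : Λ.ι → Bool) (g : Λ.ι → W), Λ.IsAdmissible u X Y side g →
    ∀ Λ' : GraphOfSubgroups W, (Λ.refine u X Y D side g).ReducesTo Λ' →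
      ¬ Ψ.IsWeaklyJSJ x Λ'

end GraphOfSubgroups

/-! ### Coxeter systems and visual decompositions -/

variable {B : Type v} {W : Type u} [Group W] {M : CoxeterMatrix B}

/-- The visual (special) subgroup generated by a set of simple reflections. -/
def visualSubgroup (cs : CoxeterSystem M W) (A : Set B) : Subgroup W :=
  Subgroup.closure (cs.simple '' A)

/-- The presentation diagram: distinct `s`, `t` are adjacent iff `m(s,t)` is finite (the value `0`
of a Coxeter matrix stands for `∞`). -/
def presentationDiagram (M : CoxeterMatrix B) : SimpleGraph B where
  Adj s t := s ≠ t ∧ M s t ≠ 0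
  symm := ⟨fun s t h => ⟨h.1.symm, by rw [M.symmetric]; exact h.2⟩⟩
  loopless := ⟨fun _ h => h.1 rfl⟩

/-- `A` separates `C` in the graph `Γ`. -/
def Separates (Γ : SimpleGraph B) (A C : Set B) : Prop :=
  ∃ c₁ ∈ C \ A, ∃ c₂ ∈ C \ A, ∀ p : Γ.Walk c₁ c₂, ∃ a ∈ p.support, a ∈ A

/-- A graph whose vertices and edges are labelled by sets of simple reflections. -/
structure VisualGraph (B : Type v) where
  ι : Type
  graph : SimpleGraph ι
  vert : ι → Set B
  edge : ι → ι → Set B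

/-- The associated graph of visual subgroups. -/
def VisualGraph.toGraph (Ψ : VisualGraph B) (cs : CoxeterSystem M W) : GraphOfSubgroups W where
  ι := Ψ.ι
  graph := Ψ.graph
  vert x := visualSubgroup cs (Ψ.vert x)
  edge x y := visualSubgroup cs (Ψ.edge x y)

/-- `Ψ` is a JSJ-amenable visual graph of groups decomposition of the Coxeter system. -/
structure IsJSJAmenable (cs : CoxeterSystem M W) (Ψ : VisualGraph B) : Prop where
  decomposition : (Ψ.toGraph cs).IsDecompositionOf ⊤
  reduced : (Ψ.toGraph cs).IsReduced
  not_separates : ∀ x y, Ψ.graph.Adj x y → ∀ A ⊆ Ψ.vert x,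
    VirtuallyAbelian (visualSubgroup cs A) →
      ¬ Separates (presentationDiagram M) A (Ψ.edge x y)

/-- `Ψ₁` is a visual `M(Ψ, ⟨V⟩)`-JSJ decomposition of `⟨V⟩`, where `V` is the set of simple
reflections at the vertex `x` of `Ψ`. -/
def IsVisualJSJ (cs : CoxeterSystem M W) (Ψ : VisualGraph B) (x : Ψ.ι) (Ψ₁ : VisualGraph B) :
    Prop :=
  (Ψ.toGraph cs).IsJSJ x (Ψ₁.toGraph cs)

end

end CoxeterJSJ

namespace CoxeterJSJ

noncomputable section

open Classical

universe u v

section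

variable {B : Type v} {W : Type u} [Group W] {M : CoxeterMatrix B}

/-! ### The geometric representation of a Coxeter group -/

/-- The coroot of `s`: twice the pairing with the simple root of `s`, where the simple roots of `s`
and `t` have inner product `-cos (π / m(s,t))`. For `m(s,t) = ∞`, coded as `0`, this is `-1`. -/
def coroot (M : CoxeterMatrix B) (s : B) : Module.Dual ℝ (B →₀ ℝ) :=
  Finsupp.linearCombination ℝ fun t => -(2 * Real.cos (Real.pi / M s t))

/-- The simple root of `s`. -/
abbrev root (s : B) : B →₀ ℝ := Finsupp.single s 1

theorem coroot_root (M : CoxeterMatrix B) (s t : B) :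
    coroot M s (root t) = -(2 * Real.cos (Real.pi / M s t)) := by
  simp [coroot]

theorem coroot_root_self (M : CoxeterMatrix B) (s : B) : coroot M s (root s) = 2 := by
  simp [coroot_root]

/-- The reflection in the simple root of `s`. -/
def rootReflection (M : CoxeterMatrix B) (s : B) : (B →₀ ℝ) ≃ₗ[ℝ] (B →₀ ℝ) :=
  Module.reflection (coroot_root_self M s)

theorem rootReflection_apply (M : CoxeterMatrix B) (s : B) (z : B →₀ ℝ) :
    rootReflection M s z = z - coroot M s z • root s :=
  Module.reflection_apply (h := coroot_root_self M s) z

theorem rootReflection_mul_pow (M : CoxeterMatrix B) (s t : B) :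
    (rootReflection M s * rootReflection M t) ^ M s t = 1 := by
  by_cases hst : s = t
  · subst hst
    rw [M.diagonal, pow_one]
    exact LinearEquiv.ext fun z =>
      Module.involutive_reflection (coroot_root_self M s) z
  have h1 : M s t ≠ 1 := M.off_diagonal s t hst
  obtain h0 | h2 | h3 : M s t = 0 ∨ M s t = 2 ∨ 3 ≤ M s t := by omega
  · rw [h0, pow_zero]
  · rw [h2]
    refine LinearEquiv.ext fun z => ?_
    have e1 : coroot M s (root t) = 0 := by simp [coroot_root, h2]
    have e2 : coroot M t (root s) = 0 := by simp [coroot_root, M.symmetric t s, h2]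
    have e3 := coroot_root_self M s
    have e4 := coroot_root_self M t
    simp only [pow_two, LinearEquiv.mul_apply, rootReflection_apply, map_sub, map_smul, e1, e2, e3,
      e4, LinearEquiv.coe_one, id_eq]
    module
  · refine LinearEquiv.ext fun z => ?_
    obtain ⟨θ, hθ⟩ : ∃ θ : ℝ, θ = 2 * (Real.pi / M s t) := ⟨_, rfl⟩
    have hm : (3 : ℝ) ≤ M s t := by exact_mod_cast h3
    have hmθ : M s t * θ = 2 * Real.pi := by rw [hθ]; field_simp
    have hsin : Real.sin θ ≠ 0 := by
      apply ne_of_gt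
      apply Real.sin_pos_of_pos_of_lt_pi
      · nlinarith [Real.pi_pos]
      · nlinarith [Real.pi_pos]
    have ht : coroot M s (root t) * coroot M t (root s) - 2 = 2 * Real.cos θ := by
      rw [coroot_root, coroot_root, M.symmetric t s, hθ, Real.cos_two_mul]
      ring
    have key := Module.reflection_mul_reflection_pow_apply (coroot_root_self M s)
      (coroot_root_self M t) (M s t) z (2 * Real.cos θ) ht.symm
    have S := fun n : ℤ => Polynomial.Chebyshev.S_two_mul_real_cos θ n
    change ((rootReflection M s * rootReflection M t) ^ M s t) z = _ at key
    rw [key]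
    have cancel : ∀ a : ℝ, a * Real.sin θ = 0 → a = 0 := fun a h =>
      (mul_eq_zero.1 h).resolve_right hsin
    rcases Nat.even_or_odd' (M s t) with ⟨j, hj | hj⟩
    · have hjθ : (j : ℝ) * θ = Real.pi := by
        have : (M s t : ℝ) = 2 * j := by exact_mod_cast hj
        rw [this] at hmθ; linarith
      have d1 : ((M s t : ℤ) - 2) / 2 = j - 1 := by omega
      have d2 : ((M s t : ℤ) - 1) / 2 = j - 1 := by omega
      have z1 : (Polynomial.Chebyshev.S ℝ (j - 1)).eval (2 * Real.cos θ) = 0 := by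
        apply cancel
        rw [S]
        push_cast
        rw [sub_add_cancel, hjθ, Real.sin_pi]
      rw [d1, d2, z1]
      simp
    · have hjθ : ((j : ℝ) + 1) * θ = 2 * Real.pi - j * θ := by
        have : (M s t : ℝ) = 2 * j + 1 := by exact_mod_cast hj
        rw [this] at hmθ; linarith
      have d1 : ((M s t : ℤ) - 2) / 2 = j - 1 := by omega
      have d2 : ((M s t : ℤ) - 1) / 2 = j := by omega
      have d3 : ((M s t : ℤ) - 3) / 2 = j - 1 := by omega
      have d4 : (M s t : ℤ) / 2 = j := by omega
      have z1 : (Polynomial.Chebyshev.S ℝ j).eval (2 * Real.cos θ) +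
          (Polynomial.Chebyshev.S ℝ (j - 1)).eval (2 * Real.cos θ) = 0 := by
        apply cancel
        rw [add_mul, S, S]
        push_cast
        rw [sub_add_cancel, hjθ, Real.sin_two_pi_sub]
        ring
      rw [d1, d2, d3, d4, z1]
      simp

/-- The geometric representation. -/
def geomRep (cs : CoxeterSystem M W) : W →* ((B →₀ ℝ) ≃ₗ[ℝ] (B →₀ ℝ)) :=
  cs.lift ⟨rootReflection M, rootReflection_mul_pow M⟩

theorem geomRep_simple (cs : CoxeterSystem M W) (s : B) :
    geomRep cs (cs.simple s) = rootReflection M s :=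
  cs.lift_apply_simple _ s

theorem geomRep_simple_apply (cs : CoxeterSystem M W) (s : B) (z : B →₀ ℝ) :
    geomRep cs (cs.simple s) z = z - coroot M s z • root s := by
  rw [geomRep_simple, rootReflection_apply]

theorem geomRep_mul_apply (cs : CoxeterSystem M W) (w w' : W) (z : B →₀ ℝ) :
    geomRep cs (w * w') z = geomRep cs w (geomRep cs w' z) := by
  rw [map_mul]; rfl

theorem geomRep_one_apply (cs : CoxeterSystem M W) (z : B →₀ ℝ) : geomRep cs 1 z = z := by
  rw [map_one]; rfl

theorem geomRep_simple_root_self (cs : CoxeterSystem M W) (s : B) :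
    geomRep cs (cs.simple s) (root s) = -root s := by
  rw [geomRep_simple_apply, coroot_root_self]
  module

/-- The coefficients in the rank two root systems: `sin (k θ) / sin θ`. -/
def dihedralCoeff (c : ℝ) : ℕ → ℝ
  | 0 => 0
  | 1 => 1
  | k + 2 => 2 * c * dihedralCoeff c (k + 1) - dihedralCoeff c k

theorem dihedralCoeff_one (k : ℕ) : dihedralCoeff 1 k = k := by
  induction k using Nat.strong_induction_on with
  | _ k ih =>
    match k with
    | 0 => simp [dihedralCoeff]
    | 1 => simp [dihedralCoeff]
    | k + 2 =>
      rw [dihedralCoeff, ih (k + 1) (by omega), ih k (by omega)]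
      push_cast
      ring

theorem dihedralCoeff_cos (θ : ℝ) (k : ℕ) :
    dihedralCoeff (Real.cos θ) k * Real.sin θ = Real.sin (k * θ) := by
  induction k using Nat.strong_induction_on with
  | _ k ih =>
    match k with
    | 0 => simp [dihedralCoeff]
    | 1 => simp [dihedralCoeff]
    | k + 2 =>
      have h1 := ih (k + 1) (by omega)
      have h0 := ih k (by omega)
      push_cast at h1 ⊢
      have e2 : ((k : ℝ) + 2) * θ = (k + 1) * θ + θ := by ring
      have e0 : (k : ℝ) * θ = (k + 1) * θ - θ := by ring
      rw [dihedralCoeff, sub_mul, mul_assoc, h1, h0, e2, e0, Real.sin_add, Real.sin_sub]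
      ring

theorem dihedralCoeff_nonneg {m k : ℕ} (hm : m ≠ 1) (hk : m = 0 ∨ k ≤ m) :
    0 ≤ dihedralCoeff (Real.cos (Real.pi / m)) k := by
  rcases Nat.eq_zero_or_pos m with rfl | hpos
  · simp [dihedralCoeff_one]
  have hk : k ≤ m := hk.resolve_left (by omega)
  have hm2 : (2 : ℝ) ≤ m := by exact_mod_cast (by omega : 2 ≤ m)
  have hsin : 0 < Real.sin (Real.pi / m) := by
    apply Real.sin_pos_of_pos_of_lt_pi
    · positivity
    · exact div_lt_self Real.pi_pos (by linarith)
  have h := dihedralCoeff_cos (Real.pi / m) k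
  have hk' : (k : ℝ) ≤ m := by exact_mod_cast hk
  have hle : (k : ℝ) * (Real.pi / m) ≤ Real.pi := by
    rw [mul_div_assoc', div_le_iff₀ (by linarith)]
    nlinarith [Real.pi_pos]
  have : 0 ≤ Real.sin (k * (Real.pi / m)) :=
    Real.sin_nonneg_of_nonneg_of_le_pi (by positivity) hle
  rw [← h] at this
  exact nonneg_of_mul_nonneg_left this hsin

theorem geomRep_alternatingWord_root (cs : CoxeterSystem M W) (s t : B) (k : ℕ) :
    geomRep cs (cs.wordProd (CoxeterSystem.alternatingWord s t k)) (root s) =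
      if Even k then
        dihedralCoeff (Real.cos (Real.pi / M s t)) (k + 1) • root s +
          dihedralCoeff (Real.cos (Real.pi / M s t)) k • root t
      else
        dihedralCoeff (Real.cos (Real.pi / M s t)) k • root s +
          dihedralCoeff (Real.cos (Real.pi / M s t)) (k + 1) • root t := by
  induction k with
  | zero => simp [CoxeterSystem.alternatingWord, dihedralCoeff]
  | succ k ih =>
    rw [CoxeterSystem.alternatingWord_succ', CoxeterSystem.wordProd_cons, geomRep_mul_apply, ih]
    by_cases hk : Even k
    · have hk' : ¬ Even (k + 1) := by simp [hk, parity_simps]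
      simp only [hk, hk', if_true, if_false, geomRep_simple_apply, map_add, map_smul,
        coroot_root_self, coroot_root, dihedralCoeff, M.symmetric t s]
      module
    · have hk' : Even (k + 1) := by simp [hk, parity_simps]
      simp only [hk, hk', if_true, if_false, geomRep_simple_apply, map_add, map_smul,
        coroot_root_self, coroot_root, dihedralCoeff]
      module

theorem root_nonneg (s : B) : (0 : B →₀ ℝ) ≤ root s := by
  intro b
  by_cases h : s = b <;> simp [root, h]

theorem geomRep_root_nonneg_of_lt (cs : CoxeterSystem M W) (w : W) (s : B)
    (h : cs.length w < cs.length (w * cs.simple s)) : 0 ≤ geomRep cs w (root s) := by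
  induction hn : cs.length w using Nat.strong_induction_on generalizing w s with
  | _ n ih =>
    by_cases hw : w = 1
    · subst hw
      rw [geomRep_one_apply]
      exact root_nonneg s
    obtain ⟨t, ht⟩ := cs.exists_rightDescent_of_ne_one hw
    have hst : s ≠ t := by
      rintro rfl
      exact absurd ht (by unfold CoxeterSystem.IsRightDescent; omega)
    let P : ℕ → Prop := fun k => cs.length (w * (cs.wordProd
      (CoxeterSystem.alternatingWord s t k))⁻¹) + k = n
    have hP1 : P 1 := by
      have := cs.isRightDescent_iff.1 ht
      simp only [P, CoxeterSystem.alternatingWord, List.concat_nil, CoxeterSystem.wordProd_singleton,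
        CoxeterSystem.inv_simple]
      omega
    have hPle : ∀ k, P k → k ≤ n := fun k hk => by simp only [P] at hk; omega
    obtain ⟨k, hk, hkmax⟩ : ∃ k, P k ∧ ∀ j, P j → j ≤ k :=
      ⟨Nat.findGreatest P n, Nat.findGreatest_spec (hPle 1 hP1) hP1,
        fun j hj => Nat.le_findGreatest (hPle j hj) hj⟩
    have hk1 : 1 ≤ k := hkmax 1 hP1
    obtain ⟨v, hv⟩ : ∃ v, v = w * (cs.wordProd (CoxeterSystem.alternatingWord s t k))⁻¹ := ⟨_, rfl⟩
    have hwv : w = v * cs.wordProd (CoxeterSystem.alternatingWord s t k) := by simp [hv]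
    have hlen : cs.length v + k = n := by rw [hv]; exact hk
    -- `v` is the shortest element of its coset of the dihedral group
    have next : ∀ r, (r = if Even k then t else s) → cs.length v < cs.length (v * cs.simple r) := by
      intro r hr
      rcases cs.length_mul_simple v r with hl | hl
      · omega
      · exfalso
        have : P (k + 1) := by
          simp only [P, CoxeterSystem.alternatingWord_succ', CoxeterSystem.wordProd_cons, mul_inv_rev,
            ← hr, CoxeterSystem.inv_simple, ← mul_assoc, ← hv]
          omega
        have := hkmax _ this
        omega
    have first : ∀ r, (r = if Even k then s else t) →
        cs.length v < cs.length (v * cs.simple r) := by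
      intro r hr
      rcases cs.length_mul_simple v r with hl | hl
      · omega
      · exfalso
        obtain ⟨j, rfl⟩ : ∃ j, k = j + 1 := ⟨k - 1, by omega⟩
        have hr' : r = if Even j then t else s := by
          rw [hr]; by_cases hj : Even j <;> simp [hj, parity_simps]
        have e : w = v * cs.simple r * cs.wordProd (CoxeterSystem.alternatingWord s t j) := by
          rw [hwv, CoxeterSystem.alternatingWord_succ', CoxeterSystem.wordProd_cons, ← hr', mul_assoc]
        have h1 := cs.length_mul_le (v * cs.simple r)
          (cs.wordProd (CoxeterSystem.alternatingWord s t j))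
        have h2 := cs.length_wordProd_le (CoxeterSystem.alternatingWord s t j)
        rw [← e] at h1
        rw [CoxeterSystem.length_alternatingWord] at h2
        omega
    have both : cs.length v < cs.length (v * cs.simple s) ∧
        cs.length v < cs.length (v * cs.simple t) := by
      by_cases hk : Even k
      · exact ⟨first s (by simp [hk]), next t (by simp [hk])⟩
      · exact ⟨next s (by simp [hk]), first t (by simp [hk])⟩
    have ps := ih _ (by omega) v s both.1 rfl
    have pt := ih _ (by omega) v t both.2 rfl
    have hm : M s t = 0 ∨ k + 1 ≤ M s t := by
      by_contra! hcon
      obtain ⟨hm0, hmk⟩ := hcon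
      have hmk : M s t ≤ k := by omega
      obtain ⟨j, hj⟩ : ∃ j, k = j + M s t := ⟨k - M s t, by omega⟩
      have split : ∀ j m, ∃ ω : List B, ω.length = j ∧
          CoxeterSystem.alternatingWord s t (j + m) = ω ++ CoxeterSystem.alternatingWord s t m := by
        intro j m
        induction j with
        | zero => exact ⟨[], rfl, by simp⟩
        | succ j ihj =>
          obtain ⟨ω, h1, h2⟩ := ihj
          refine ⟨(if Even (j + m) then t else s) :: ω, by simp [h1], ?_⟩
          rw [show j + 1 + m = (j + m) + 1 by omega, CoxeterSystem.alternatingWord_succ', h2]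
          rfl
      obtain ⟨ω, hω, hω'⟩ := split j (M s t)
      rw [← hj] at hω'
      obtain ⟨q, hq⟩ : ∃ q, M s t = q + 1 := ⟨M s t - 1, by omega⟩
      have braid := cs.wordProd_braidWord_eq s t
      have e : w * cs.simple s = v * cs.wordProd ω *
          cs.wordProd (CoxeterSystem.alternatingWord s t q) := by
        rw [hwv, hω', CoxeterSystem.wordProd_append]
        simp only [CoxeterSystem.braidWord] at braid
        rw [braid, M.symmetric t s, hq, CoxeterSystem.alternatingWord_succ,
          CoxeterSystem.wordProd_concat]
        simp [mul_assoc]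
      have h1 := cs.length_mul_le (v * cs.wordProd ω)
          (cs.wordProd (CoxeterSystem.alternatingWord s t q))
      have h2 := cs.length_wordProd_le (CoxeterSystem.alternatingWord s t q)
      have h3 := cs.length_mul_le v (cs.wordProd ω)
      have h4 := cs.length_wordProd_le ω
      rw [← e] at h1
      rw [CoxeterSystem.length_alternatingWord] at h2
      omega
    have hne := M.off_diagonal s t hst
    have c1 := dihedralCoeff_nonneg (k := k + 1) hne (by omega)
    have c0 := dihedralCoeff_nonneg (k := k) hne (by omega)
    rw [hwv, geomRep_mul_apply, geomRep_alternatingWord_root]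
    split_ifs
    · rw [map_add, map_smul, map_smul]
      exact add_nonneg (smul_nonneg c1 ps) (smul_nonneg c0 pt)
    · rw [map_add, map_smul, map_smul]
      exact add_nonneg (smul_nonneg c0 ps) (smul_nonneg c1 pt)

theorem geomRep_root_nonpos_of_lt (cs : CoxeterSystem M W) (w : W) (s : B)
    (h : cs.length (w * cs.simple s) < cs.length w) : geomRep cs w (root s) ≤ 0 := by
  have := geomRep_root_nonneg_of_lt cs (w * cs.simple s) s (by simpa using h)
  rw [geomRep_mul_apply, geomRep_simple_root_self, map_neg] at this
  exact neg_nonneg.1 this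

theorem geomRep_injective (cs : CoxeterSystem M W) : Function.Injective (geomRep cs) := by
  rw [injective_iff_map_eq_one]
  intro w hw
  by_contra hne
  obtain ⟨s, hs⟩ := cs.exists_rightDescent_of_ne_one hne
  have := geomRep_root_nonpos_of_lt cs w s hs
  rw [hw] at this
  have := this s
  simp at this
  linarith

end

section

variable {B : Type v} {W : Type u} [Group W] {M : CoxeterMatrix B}

/-- Twice the invariant bilinear form. -/
def rootForm (M : CoxeterMatrix B) : (B →₀ ℝ) →ₗ[ℝ] Module.Dual ℝ (B →₀ ℝ) :=
  Finsupp.linearCombination ℝ (coroot M)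

theorem rootForm_root (M : CoxeterMatrix B) (s : B) : rootForm M (root s) = coroot M s := by
  simp [rootForm]

theorem rootForm_apply_root (M : CoxeterMatrix B) (x : B →₀ ℝ) (s : B) :
    rootForm M x (root s) = coroot M s x := by
  have : (rootForm M).flip (root s) = coroot M s := by
    ext t
    simp only [LinearMap.coe_comp, Function.comp_apply, Finsupp.lsingle_apply,
      LinearMap.flip_apply]
    rw [rootForm_root, coroot_root, coroot_root, M.symmetric]
  rw [← this]
  rfl

theorem rootForm_geomRep (cs : CoxeterSystem M W) (w : W) (x y : B →₀ ℝ) :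
    rootForm M (geomRep cs w x) (geomRep cs w y) = rootForm M x y := by
  induction w using cs.simple_induction_left generalizing x y with
  | one => simp
  | mul_simple_left w s ih =>
    rw [geomRep_mul_apply, geomRep_mul_apply, ← ih x y, geomRep_simple_apply,
      geomRep_simple_apply]
    simp only [map_sub, map_smul, LinearMap.sub_apply, LinearMap.smul_apply, rootForm_root,
      rootForm_apply_root, coroot_root_self, smul_eq_mul]
    ring

theorem simple_conj_of_geomRep_root (cs : CoxeterSystem M W) {d : W} {s t : B}
    (h : geomRep cs d (root t) = root s) : cs.simple s * d = d * cs.simple t := by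
  apply geomRep_injective cs
  refine LinearEquiv.ext fun v => ?_
  rw [geomRep_mul_apply, geomRep_mul_apply, geomRep_simple_apply, geomRep_simple_apply, map_sub,
    map_smul, h, ← rootForm_root, ← rootForm_root, ← h, rootForm_geomRep]

/-! ### Visual subgroups -/

theorem simple_mem_visualSubgroup (cs : CoxeterSystem M W) {A : Set B} {s : B} (hs : s ∈ A) :
    cs.simple s ∈ visualSubgroup cs A :=
  Subgroup.subset_closure ⟨s, hs, rfl⟩

theorem visualSubgroup_le_of_forall (cs : CoxeterSystem M W) {A : Set B} {H : Subgroup W}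
    (h : ∀ s ∈ A, cs.simple s ∈ H) : visualSubgroup cs A ≤ H :=
  (Subgroup.closure_le _).2 (by rintro _ ⟨s, hs, rfl⟩; exact h s hs)

theorem visualSubgroup_mono (cs : CoxeterSystem M W) {A A' : Set B} (h : A ⊆ A') :
    visualSubgroup cs A ≤ visualSubgroup cs A' :=
  visualSubgroup_le_of_forall cs fun _ hs => simple_mem_visualSubgroup cs (h hs)

theorem geomRep_apply_of_notMem (cs : CoxeterSystem M W) {A : Set B} {w : W}
    (hw : w ∈ visualSubgroup cs A) (z : B →₀ ℝ) {b : B} (hb : b ∉ A) :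
    geomRep cs w z b = z b := by
  induction hw using Subgroup.closure_induction generalizing z with
  | mem x hx =>
    obtain ⟨s, hs, rfl⟩ := hx
    have : s ≠ b := fun h => hb (h ▸ hs)
    simp [geomRep_simple_apply, this]
  | one => simp
  | mul x y _ _ ihx ihy => rw [geomRep_mul_apply, ihx, ihy]
  | inv x _ ih =>
    rw [← ih, ← geomRep_mul_apply, mul_inv_cancel, geomRep_one_apply]

@[simp]
theorem simple_mem_visualSubgroup_iff (cs : CoxeterSystem M W) {A : Set B} {s : B} :
    cs.simple s ∈ visualSubgroup cs A ↔ s ∈ A := by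
  refine ⟨fun h => ?_, simple_mem_visualSubgroup cs⟩
  by_contra hs
  have := geomRep_apply_of_notMem cs h (root s) hs
  rw [geomRep_simple_root_self] at this
  simp at this
  linarith

theorem visualSubgroup_le_iff (cs : CoxeterSystem M W) {A A' : Set B} :
    visualSubgroup cs A ≤ visualSubgroup cs A' ↔ A ⊆ A' :=
  ⟨fun h _ hs => (simple_mem_visualSubgroup_iff cs).1 (h (simple_mem_visualSubgroup cs hs)),
    visualSubgroup_mono cs⟩

theorem visualSubgroup_injective (cs : CoxeterSystem M W) :
    Function.Injective (visualSubgroup cs) := fun _ _ h =>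
  Set.Subset.antisymm ((visualSubgroup_le_iff cs).1 h.le) ((visualSubgroup_le_iff cs).1 h.ge)

theorem exists_leftDescent_mem (cs : CoxeterSystem M W) {A : Set B} {w : W}
    (hw : w ∈ visualSubgroup cs A) (hne : w ≠ 1) : ∃ s ∈ A, cs.IsLeftDescent w s := by
  obtain ⟨s, hs⟩ := cs.exists_leftDescent_of_ne_one hne
  refine ⟨s, ?_, hs⟩
  by_contra hsA
  have h1 := geomRep_apply_of_notMem cs (inv_mem hw) (root s) hsA
  have h2 := geomRep_root_nonpos_of_lt cs w⁻¹ s (cs.isLeftDescent_inv_iff.1 (by simpa using hs)) s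
  rw [h1] at h2
  simp at h2
  linarith

/-- The Coxeter matrix of a subset of the generators. -/
def restrictMatrix (M : CoxeterMatrix B) (A : Set B) : CoxeterMatrix A where
  M := Matrix.of fun a b => M a b
  isSymm := by ext a b; exact M.symmetric _ _
  diagonal a := M.diagonal a
  off_diagonal a b h := M.off_diagonal a b fun h' => h (Subtype.ext h')

/-- The homomorphism from the Coxeter group of a subset of the generators. -/
def restrictHom (cs : CoxeterSystem M W) (A : Set B) : (restrictMatrix M A).Group →* W :=
  (restrictMatrix M A).toCoxeterSystem.lift
    ⟨fun a => cs.simple a, fun a b => cs.simple_mul_simple_pow a b⟩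

theorem restrictHom_simple (cs : CoxeterSystem M W) (A : Set B) (a : A) :
    restrictHom cs A ((restrictMatrix M A).toCoxeterSystem.simple a) = cs.simple a :=
  CoxeterSystem.lift_apply_simple _ _ a

theorem geomRep_restrictHom (cs : CoxeterSystem M W) (A : Set B) (w : (restrictMatrix M A).Group)
    (z : A →₀ ℝ) :
    geomRep cs (restrictHom cs A w) (z.mapDomain Subtype.val) =
      (geomRep (restrictMatrix M A).toCoxeterSystem w z).mapDomain Subtype.val := by
  induction w using (restrictMatrix M A).toCoxeterSystem.simple_induction_left
    generalizing z with
  | one => simp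
  | mul_simple_left w s ih =>
    rw [map_mul, geomRep_mul_apply, geomRep_mul_apply, ih, restrictHom_simple,
      geomRep_simple_apply, geomRep_simple_apply]
    generalize geomRep (restrictMatrix M A).toCoxeterSystem w z = y
    have hc : coroot M s (y.mapDomain Subtype.val) = coroot (restrictMatrix M A) s y := by
      rw [coroot, coroot, Finsupp.linearCombination_mapDomain]
      rfl
    have hadd := map_sub (Finsupp.lmapDomain ℝ ℝ (Subtype.val : A → B)) y
      (coroot (restrictMatrix M A) s y • root s)
    rw [map_smul] at hadd
    simp only [Finsupp.lmapDomain_apply, Finsupp.mapDomain_single] at hadd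
    rw [hc, hadd]

theorem restrictHom_injective (cs : CoxeterSystem M W) (A : Set B) :
    Function.Injective (restrictHom cs A) := by
  rw [injective_iff_map_eq_one]
  intro w hw
  apply geomRep_injective (restrictMatrix M A).toCoxeterSystem
  refine LinearEquiv.ext fun z => ?_
  have := geomRep_restrictHom cs A w z
  rw [hw, geomRep_one_apply] at this
  rw [geomRep_one_apply]
  exact (Finsupp.mapDomain_injective Subtype.val_injective this).symm

theorem restrictHom_range (cs : CoxeterSystem M W) (A : Set B) :
    (restrictHom cs A).range = visualSubgroup cs A := by
  rw [MonoidHom.range_eq_map,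
    ← (restrictMatrix M A).toCoxeterSystem.subgroup_closure_range_simple, MonoidHom.map_closure,
    ← Set.range_comp, visualSubgroup]
  congr 1
  ext w
  constructor
  · rintro ⟨a, rfl⟩
    exact ⟨a, a.2, (restrictHom_simple cs A a).symm⟩
  · rintro ⟨a, ha, rfl⟩
    exact ⟨⟨a, ha⟩, restrictHom_simple cs A ⟨a, ha⟩⟩

/-- A visual subgroup is presented by the Coxeter relations between its generators. -/
theorem exists_hom_visualSubgroup (cs : CoxeterSystem M W) (A : Set B) {G : Type*} [Group G]
    (f : A → G) (hf : ∀ a b : A, (f a * f b) ^ M a b = 1) :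
    ∃ F : visualSubgroup cs A →* G,
      ∀ a : A, F ⟨cs.simple a, simple_mem_visualSubgroup cs a.2⟩ = f a := by
  let e := MonoidHom.ofInjective (restrictHom_injective cs A)
  refine ⟨((restrictMatrix M A).toCoxeterSystem.lift ⟨f, hf⟩).comp
    (e.symm.toMonoidHom.comp (Subgroup.inclusion (restrictHom_range cs A).ge)), fun a => ?_⟩
  have : e.symm ⟨cs.simple a, (restrictHom_range cs A).ge (simple_mem_visualSubgroup cs a.2)⟩ =
      (restrictMatrix M A).toCoxeterSystem.simple a := by
    rw [MulEquiv.symm_apply_eq]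
    exact Subtype.ext (restrictHom_simple cs A a).symm
  change (restrictMatrix M A).toCoxeterSystem.lift ⟨f, hf⟩ (e.symm ⟨cs.simple a, _⟩) = f a
  rw [this]
  exact CoxeterSystem.lift_apply_simple _ _ a

/-! ### Intersections of conjugates of visual subgroups -/

theorem finsupp_eq_sum_root (x : B →₀ ℝ) : x = x.sum fun b c => c • root b := by
  conv_lhs => rw [← Finsupp.sum_single x]
  simp [root]

/-- If `d` is of minimal length in `⟨Q⟩ d ⟨Z⟩` then `⟨Q⟩ ∩ d ⟨Z⟩ d⁻¹` is visual. -/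
theorem mem_visualSubgroup_of_mul_eq (cs : CoxeterSystem M W) {Q Z : Set B} {d : W}
    (hQ : ∀ s ∈ Q, cs.length d < cs.length (cs.simple s * d))
    (hZ : ∀ z ∈ Z, cs.length d < cs.length (d * cs.simple z)) {w x : W}
    (hw : w ∈ visualSubgroup cs Q) (hx : x ∈ visualSubgroup cs Z) (h : w * d = d * x) :
    w ∈ visualSubgroup cs {s | s ∈ Q ∧ ∃ z ∈ Z, cs.simple s * d = d * cs.simple z} := by
  induction hn : cs.length w using Nat.strong_induction_on generalizing w x with
  | _ n ih =>
    by_cases hne : w = 1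
    · rw [hne]; exact one_mem _
    obtain ⟨s, hsQ, hs⟩ := exists_leftDescent_mem cs hw hne
    have posQ : ∀ b ∈ Q, 0 ≤ geomRep cs d⁻¹ (root b) := fun b hb => by
      apply geomRep_root_nonneg_of_lt
      have := hQ b hb
      rwa [← cs.length_inv d, ← cs.length_inv (cs.simple b * d), mul_inv_rev, cs.inv_simple] at this
    have posZ : ∀ b ∈ Z, 0 ≤ geomRep cs d (root b) := fun b hb =>
      geomRep_root_nonneg_of_lt cs d b (hZ b hb)
    obtain ⟨β, hβ⟩ : ∃ β, β = geomRep cs d⁻¹ (root s) := ⟨_, rfl⟩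
    have hβ0 : 0 ≤ β := hβ ▸ posQ s hsQ
    have hdβ : geomRep cs d β = root s := by
      rw [hβ, ← geomRep_mul_apply, mul_inv_cancel, geomRep_one_apply]
    have hγ : geomRep cs w⁻¹ (root s) ≤ 0 :=
      geomRep_root_nonpos_of_lt cs w⁻¹ s (cs.isLeftDescent_inv_iff.1 (by simpa using hs))
    have hγQ : ∀ b ∉ Q, geomRep cs w⁻¹ (root s) b = 0 := fun b hb => by
      rw [geomRep_apply_of_notMem cs (inv_mem hw) _ hb]
      have : s ≠ b := fun h => hb (h ▸ hsQ)
      simp [root, this]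
    have hxβ : geomRep cs x⁻¹ β ≤ 0 := by
      have e : x⁻¹ * d⁻¹ = d⁻¹ * w⁻¹ := by rw [← mul_inv_rev, ← mul_inv_rev, h]
      rw [hβ, ← geomRep_mul_apply, e, geomRep_mul_apply,
        finsupp_eq_sum_root (geomRep cs w⁻¹ (root s)), Finsupp.sum, map_sum]
      refine Finset.sum_nonpos fun b hb => ?_
      rw [map_smul]
      have hbQ : b ∈ Q := by
        by_contra hbQ
        exact Finsupp.mem_support_iff.1 hb (hγQ b hbQ)
      exact smul_nonpos_of_nonpos_of_nonneg (hγ b) (posQ b hbQ)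
    have hβZ : ∀ b ∈ β.support, b ∈ Z := fun b hb => by
      by_contra hbZ
      have h1 := hxβ b
      rw [geomRep_apply_of_notMem cs (inv_mem hx) β hbZ] at h1
      exact Finsupp.mem_support_iff.1 hb (le_antisymm h1 (hβ0 b))
    have hβne : β ≠ 0 := fun h0 => by
      rw [h0, map_zero] at hdβ
      have := DFunLike.congr_fun hdβ s
      simp at this
    obtain ⟨z, hz⟩ := Finsupp.support_nonempty_iff.2 hβne
    have hβz : 0 < β z := lt_of_le_of_ne (hβ0 z) (Finsupp.mem_support_iff.1 hz).symm
    have hsum : root s = ∑ b ∈ β.support, β b • geomRep cs d (root b) := by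
      conv_lhs => rw [← hdβ, finsupp_eq_sum_root β, Finsupp.sum, map_sum]
      exact Finset.sum_congr rfl fun b _ => map_smul _ _ _
    have hoff : ∀ c, c ≠ s → geomRep cs d (root z) c = 0 := fun c hc => by
      have h1 := DFunLike.congr_fun hsum c
      rw [Finsupp.finsetSum_apply, Finsupp.single_eq_of_ne hc, eq_comm,
        Finset.sum_eq_zero_iff_of_nonneg] at h1
      · have := h1 z hz
        rw [Finsupp.smul_apply, smul_eq_mul] at this
        exact (mul_eq_zero.1 this).resolve_left hβz.ne'
      · intro b hb
        exact mul_nonneg (hβ0 b) (posZ b (hβZ b hb) c)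
    obtain ⟨l, hl⟩ : ∃ l, l = geomRep cs d (root z) s := ⟨_, rfl⟩
    have hl0 : 0 ≤ l := hl ▸ posZ z (hβZ z hz) s
    have hdz : geomRep cs d (root z) = l • root s := by
      ext c
      by_cases hc : c = s
      · subst hc; simp [hl]
      · rw [hoff c hc]; simp [root, Ne.symm hc]
    have hl1 : l = 1 := by
      have := rootForm_geomRep cs d (root z) (root z)
      rw [hdz, map_smul, map_smul, LinearMap.smul_apply, rootForm_root, rootForm_root,
        coroot_root_self, coroot_root_self, smul_eq_mul, smul_eq_mul] at this
      nlinarith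
    rw [hl1, one_smul] at hdz
    have hconj := simple_conj_of_geomRep_root cs hdz
    have := ih (cs.length (cs.simple s * w)) (hn ▸ hs)
      (mul_mem (simple_mem_visualSubgroup cs hsQ) hw)
      (mul_mem (simple_mem_visualSubgroup cs (hβZ z hz)) hx)
      (by rw [mul_assoc, h, ← mul_assoc, hconj, mul_assoc]) rfl
    have hsR := simple_mem_visualSubgroup cs
      (A := {s | s ∈ Q ∧ ∃ z ∈ Z, cs.simple s * d = d * cs.simple z})
      ⟨hsQ, z, hβZ z hz, hconj⟩
    have := mul_mem hsR this
    rwa [cs.simple_mul_simple_cancel_left] at this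

theorem mem_conjSubgroup {g w : W} {K : Subgroup W} :
    w ∈ conjSubgroup g K ↔ g⁻¹ * w * g ∈ K := by
  constructor
  · rintro ⟨k, hk, rfl⟩
    simpa [mul_assoc] using hk
  · intro h
    exact ⟨_, h, by simp [mul_assoc]⟩

theorem conjSubgroup_one (K : Subgroup W) : conjSubgroup 1 K = K := by
  ext w; simp [mem_conjSubgroup]

theorem conjSubgroup_mono (g : W) {K K' : Subgroup W} (h : K ≤ K') :
    conjSubgroup g K ≤ conjSubgroup g K' := fun w hw => by
  rw [mem_conjSubgroup] at *
  exact h hw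

/-- The intersection of `⟨Q⟩` with a conjugate of `⟨Z⟩` lies in a `⟨Q⟩`-conjugate of a visual
subgroup of `⟨Q⟩` which lies in a conjugate of `⟨Z⟩`. -/
theorem exists_inf_conjSubgroup_le (cs : CoxeterSystem M W) (Q Z : Set B) (g : W) :
    ∃ q ∈ visualSubgroup cs Q, ∃ x ∈ visualSubgroup cs Z, ∃ R ⊆ Q,
      visualSubgroup cs R ≤ conjSubgroup (q * g * x) (visualSubgroup cs Z) ∧
      visualSubgroup cs Q ⊓ conjSubgroup g (visualSubgroup cs Z) ≤
        conjSubgroup q⁻¹ (visualSubgroup cs R) := by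
  let D : Set W := {d | ∃ q ∈ visualSubgroup cs Q, ∃ x ∈ visualSubgroup cs Z, d = q * g * x}
  obtain ⟨d, ⟨q, hq, x, hx, rfl⟩, hmin⟩ : ∃ d ∈ D, ∀ d' ∈ D, cs.length d ≤ cs.length d' := by
    have hne : D.Nonempty := ⟨g, 1, one_mem _, 1, one_mem _, by simp⟩
    exact ⟨Function.argminOn cs.length D hne, Function.argminOn_mem _ _ _,
      fun d' hd' => Function.argminOn_le _ _ hd'⟩
  refine ⟨q, hq, x, hx, {s | s ∈ Q ∧ ∃ z ∈ Z, cs.simple s * (q * g * x) =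
    q * g * x * cs.simple z}, fun s hs => hs.1, ?_, ?_⟩
  · refine visualSubgroup_le_of_forall cs fun s hs => ?_
    obtain ⟨-, z, hz, h⟩ := hs
    rw [mem_conjSubgroup, mul_assoc, h, inv_mul_cancel_left]
    exact simple_mem_visualSubgroup cs hz
  · rintro w ⟨hwQ, hwZ⟩
    rw [mem_conjSubgroup, inv_inv]
    have hwZ : w ∈ conjSubgroup g (visualSubgroup cs Z) := hwZ
    rw [mem_conjSubgroup] at hwZ
    refine mem_visualSubgroup_of_mul_eq cs (d := q * g * x) (x := x⁻¹ * (g⁻¹ * w * g) * x) ?_ ?_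
      (mul_mem (mul_mem hq hwQ) (inv_mem hq)) (mul_mem (mul_mem (inv_mem hx) hwZ) hx)
      (by group)
    · intro s hs
      refine lt_of_le_of_ne (hmin _ ⟨cs.simple s * q,
        mul_mem (simple_mem_visualSubgroup cs hs) hq, x, hx, by simp only [mul_assoc]⟩) ?_
      exact (cs.length_simple_mul_ne _ _).symm
    · intro z hz
      refine lt_of_le_of_ne (hmin _ ⟨q, hq, x * cs.simple z,
        mul_mem hx (simple_mem_visualSubgroup cs hz), by simp only [mul_assoc]⟩) ?_
      exact (cs.length_mul_simple_ne _ _).symm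

end

/-! ### Hyperbolic elements of amalgamated products -/

section Pushout

open Monoid Monoid.PushoutI Monoid.PushoutI.NormalWord

variable {ι : Type*} {G : ι → Type*} {H : Type*} [∀ i, Group (G i)] [Group H] {φ : ∀ i, H →* G i}
  {d : Transversal φ}

theorem length_toList_cons {i : ι} (g : G i) (w : NormalWord d) (hmw : w.fstIdx ≠ some i)
    (hgr : g ∉ (φ i).range) : (cons g w hmw hgr).toList.length = w.toList.length + 1 := by
  simp [NormalWord.cons, CoprodI.Word.cons]

theorem fstIdx_cons {i : ι} (g : G i) (w : NormalWord d) (hmw : w.fstIdx ≠ some i)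
    (hgr : g ∉ (φ i).range) : (cons g w hmw hgr).fstIdx = some i := by
  simp [NormalWord.cons]

theorem length_base_smul (h : H) (w : NormalWord d) :
    (base φ h • w).toList.length = w.toList.length := rfl

theorem length_of_smul_le_of_fstIdx_ne {i : ι} (g : G i) (w : NormalWord d)
    (hmw : w.fstIdx ≠ some i) : (of (φ := φ) i g • w).toList.length ≤ w.toList.length + 1 := by
  by_cases hg : g ∈ (φ i).range
  · obtain ⟨h, rfl⟩ := hg
    rw [of_apply_eq_base, length_base_smul]
    omega
  · rw [← cons_eq_smul g w hmw hg, length_toList_cons]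

theorem length_of_smul_le {i : ι} (g : G i) (w : NormalWord d) :
    (of (φ := φ) i g • w).toList.length ≤ w.toList.length + 1 := by
  induction w using consRecOn generalizing g with
  | empty => exact length_of_smul_le_of_fstIdx_ne g _ (by simp [CoprodI.Word.fstIdx])
  | cons j g' w hmw _ hgr _ ih =>
    by_cases hij : j = i
    · subst hij
      have := length_of_smul_le_of_fstIdx_ne (g * g') w hmw
      rw [length_toList_cons, cons_eq_smul, smul_smul, ← map_mul]
      omega
    · exact length_of_smul_le_of_fstIdx_ne g _ (by rw [fstIdx_cons]; simpa using hij)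
  | base h w _ ih =>
    rw [← of_apply_eq_base φ i, smul_smul, ← map_mul, of_apply_eq_base, length_base_smul]
    exact ih _

theorem exists_length_smul_le (p : PushoutI φ) :
    ∃ C, ∀ w : NormalWord d, (p • w).toList.length ≤ w.toList.length + C := by
  induction p using PushoutI.induction_on with
  | of i g => exact ⟨1, length_of_smul_le g⟩
  | base h => exact ⟨0, fun w => (length_base_smul h w).le⟩
  | mul x y ihx ihy =>
    obtain ⟨C, hC⟩ := ihx
    obtain ⟨C', hC'⟩ := ihy
    refine ⟨C + C', fun w => ?_⟩
    rw [mul_smul]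
    have := hC (y • w)
    have := hC' w
    omega

theorem length_pow_smul_empty {i j : ι} (hij : i ≠ j) {s : G i} {t : G j}
    (hs : s ∉ (φ i).range) (ht : t ∉ (φ j).range) (n : ℕ) :
    ((of (φ := φ) i s * of j t) ^ n • (empty : NormalWord d)).toList.length = 2 * n ∧
      ((of (φ := φ) i s * of j t) ^ n • (empty : NormalWord d)).fstIdx ≠ some j := by
  induction n with
  | zero => simp [CoprodI.Word.fstIdx]
  | succ n ih =>
    obtain ⟨h1, h2⟩ := ih
    rw [pow_succ', mul_smul, mul_smul, ← cons_eq_smul t _ h2 ht,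
      ← cons_eq_smul s _ (by rw [fstIdx_cons]; simpa using hij.symm) hs]
    refine ⟨?_, by rw [fstIdx_cons]; simpa using hij⟩
    rw [length_toList_cons, length_toList_cons, h1]
    ring

theorem of_mul_of_pow_ne_one (hφ : ∀ i, Function.Injective (φ i)) {i j : ι} (hij : i ≠ j) {s : G i}
    {t : G j} (hs : s ∉ (φ i).range) (ht : t ∉ (φ j).range) {n : ℕ} (hn : n ≠ 0) :
    (of (φ := φ) i s * of j t) ^ n ≠ 1 := by
  obtain ⟨d⟩ := transversal_nonempty φ hφ
  intro h
  have := (length_pow_smul_empty (d := d) hij hs ht n).1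
  rw [h, one_smul] at this
  simp at this
  exact hn this

theorem of_mul_of_ne_conj (hφ : ∀ i, Function.Injective (φ i)) {i j : ι} (hij : i ≠ j) {s : G i}
    {t : G j} (hs : s ∉ (φ i).range) (ht : t ∉ (φ j).range) (k : PushoutI φ) {l : ι} (g : G l) :
    of (φ := φ) i s * of j t ≠ k * of l g * k⁻¹ := by
  obtain ⟨d⟩ := transversal_nonempty φ hφ
  intro h
  obtain ⟨C, hC⟩ := exists_length_smul_le (d := d) k
  obtain ⟨n, hn⟩ : ∃ n, n = C + (k⁻¹ • (empty : NormalWord d)).toList.length + 1 := ⟨_, rfl⟩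
  have h1 := (length_pow_smul_empty (d := d) hij hs ht n).1
  rw [h, conj_pow, mul_smul, mul_smul, ← map_pow] at h1
  have h2 := hC (of (φ := φ) l (g ^ n) • k⁻¹ • (empty : NormalWord d))
  have h3 := length_of_smul_le (φ := φ) (g ^ n) (k⁻¹ • (empty : NormalWord d))
  omega

end Pushout

/-! ### The amalgamated product given by an edge of a tree of groups -/

section Edge

variable {W : Type u} [Group W]

theorem forall_mem_of_eq_iSup {ι P : Type*} [Group P] {S : Set ι} {V : ι → Subgroup W}
    {X : Subgroup W} (hX : X = ⨆ v ∈ S, V v) (f : X →* P) (K : Subgroup P)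
    (h : ∀ v ∈ S, ∀ w ∈ V v, ∀ hw : w ∈ X, f ⟨w, hw⟩ ∈ K) (g : X) : f g ∈ K := by
  have hle : X ≤ (K.comap f).map X.subtype := by
    nth_rw 1 [hX]
    refine iSup₂_le fun v hv w hw => ?_
    have hwX : w ∈ X := hX ▸ (le_iSup₂_of_le (f := fun v (_ : v ∈ S) => V v) v hv le_rfl) hw
    exact ⟨⟨w, hwX⟩, h v hv w hw hwX, rfl⟩
  obtain ⟨g', hg', e⟩ := hle g.2
  rwa [Subtype.ext e] at hg'

variable {ι : Type*} {K : ι → Subgroup W} {E : Subgroup W}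

/-- The inclusions of the amalgamated subgroup into the factors. -/
def amalgamIncl (hK : ∀ i, E ≤ K i) (i : ι) : E →* K i :=
  Subgroup.inclusion (hK i)

theorem amalgamIncl_injective (hK : ∀ i, E ≤ K i) (i : ι) :
    Function.Injective (amalgamIncl hK i) :=
  Subgroup.inclusion_injective _

theorem mem_range_amalgamIncl (hK : ∀ i, E ≤ K i) {i : ι} {g : K i} :
    g ∈ (amalgamIncl hK i).range ↔ (g : W) ∈ E := by
  constructor
  · rintro ⟨e, rfl⟩
    exact e.2
  · intro h
    exact ⟨⟨g, h⟩, rfl⟩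

/-- The homomorphism from an amalgamated product of subgroups induced by the inclusions. -/
def amalgamHom (hK : ∀ i, E ≤ K i) : Monoid.PushoutI (amalgamIncl hK) →* W :=
  Monoid.PushoutI.lift (fun i => (K i).subtype) E.subtype (fun _ => rfl)

theorem amalgamHom_of (hK : ∀ i, E ≤ K i) (i : ι) (g : K i) :
    amalgamHom hK (Monoid.PushoutI.of i g) = g :=
  Monoid.PushoutI.lift_of (φ := amalgamIncl hK) (fun i => (K i).subtype) E.subtype (fun _ => rfl) g

theorem amalgamHom_base (hK : ∀ i, E ≤ K i) (e : E) :
    amalgamHom hK (Monoid.PushoutI.base _ e) = e :=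
  Monoid.PushoutI.lift_base (φ := amalgamIncl hK) (fun i => (K i).subtype) E.subtype
    (fun _ => rfl) e

theorem inf_le_of_amalgamHom_injective (hK : ∀ i, E ≤ K i)
    (h : Function.Injective (amalgamHom hK)) {i j : ι} (hij : i ≠ j) : K i ⊓ K j ≤ E := by
  rintro w ⟨hwX, hwY⟩
  have e : Monoid.PushoutI.of (φ := amalgamIncl hK) i ⟨w, hwX⟩ =
      Monoid.PushoutI.of (φ := amalgamIncl hK) j ⟨w, hwY⟩ :=
    h (by rw [amalgamHom_of, amalgamHom_of])
  have := (Monoid.PushoutI.inf_of_range_eq_base_range (amalgamIncl_injective hK)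
    hij).le ⟨⟨⟨w, hwX⟩, rfl⟩, ⟨⟨w, hwY⟩, e.symm⟩⟩
  obtain ⟨g, hg⟩ := this
  have := congrArg (amalgamHom hK) hg
  rw [amalgamHom_base, amalgamHom_of] at this
  change (g : W) = w at this
  exact this ▸ g.2

theorem mul_pow_ne_one_of_amalgamHom_injective (hK : ∀ i, E ≤ K i)
    (h : Function.Injective (amalgamHom hK)) {i j : ι} (hij : i ≠ j) {s t : W} (hs : s ∈ K i)
    (hsE : s ∉ E) (ht : t ∈ K j) (htE : t ∉ E) {n : ℕ} (hn : n ≠ 0) : (s * t) ^ n ≠ 1 := by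
  intro h1
  refine of_mul_of_pow_ne_one (amalgamIncl_injective hK) hij
    (s := ⟨s, hs⟩) (t := ⟨t, ht⟩) (by rwa [mem_range_amalgamIncl])
    (by rwa [mem_range_amalgamIncl]) hn (h ?_)
  rw [map_pow, map_mul, amalgamHom_of, amalgamHom_of, map_one]
  exact h1

theorem mul_notMem_conjSubgroup_of_amalgamHom_injective (hK : ∀ i, E ≤ K i)
    (h : Function.Injective (amalgamHom hK)) {i j : ι} (hij : i ≠ j) {s t : W} (hs : s ∈ K i)
    (hsE : s ∉ E) (ht : t ∈ K j) (htE : t ∉ E) {k : W} (hk : k ∈ (amalgamHom hK).range) (l : ι) :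
    s * t ∉ conjSubgroup k (K l) := by
  rintro ⟨g, hg, hg'⟩
  obtain ⟨k, rfl⟩ := hk
  refine of_mul_of_ne_conj (amalgamIncl_injective hK) hij
    (s := ⟨s, hs⟩) (t := ⟨t, ht⟩) (by rwa [mem_range_amalgamIncl])
    (by rwa [mem_range_amalgamIncl]) k (l := l) ⟨g, hg⟩ (h ?_)
  rw [map_mul, map_mul, map_mul, map_inv, amalgamHom_of, amalgamHom_of, amalgamHom_of]
  exact hg'.symm

/-- The vertices on the side of `a` of the edge `ab`. -/
def edgeSide {ι : Type*} (G : SimpleGraph ι) (a b : ι) : Set ι :=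
  {v | (G.deleteEdges {s(a, b)}).Reachable v a}

theorem left_mem_edgeSide {ι : Type*} (G : SimpleGraph ι) (a b : ι) : a ∈ edgeSide G a b :=
  SimpleGraph.Reachable.refl a

theorem disjoint_edgeSide {ι : Type*} {G : SimpleGraph ι} (hG : G.IsTree) {a b v : ι}
    (hab : G.Adj a b) (ha : v ∈ edgeSide G a b) : v ∉ edgeSide G b a := by
  intro hb
  have h := SimpleGraph.isAcyclic_iff_forall_adj_isBridge.1 hG.isAcyclic hab
  rw [SimpleGraph.isBridge_iff] at h
  unfold edgeSide at hb
  rw [Sym2.eq_swap] at hb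
  exact h (ha.symm.trans hb)

theorem mem_edgeSide_of_adj {ι : Type*} {G : SimpleGraph ι} {a b v w : ι} (h : G.Adj v w)
    (hv : v ∈ edgeSide G a b) (hne : s(v, w) ≠ s(a, b)) : w ∈ edgeSide G a b := by
  refine SimpleGraph.Reachable.trans (SimpleGraph.Adj.reachable ?_) hv
  rw [SimpleGraph.deleteEdges_adj]
  exact ⟨h.symm, by simpa [Sym2.eq_swap] using hne⟩

theorem mem_edgeSide_or {ι : Type*} {G : SimpleGraph ι} (hG : G.Connected) (a b v : ι) :
    v ∈ edgeSide G a b ∨ v ∈ edgeSide G b a := by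
  obtain ⟨p⟩ := hG.preconnected a v
  induction p using SimpleGraph.Walk.concatRec with
  | Hnil => exact Or.inl (left_mem_edgeSide G _ b)
  | @Hconcat a v w p h ih =>
    by_cases hne : s(v, w) = s(a, b)
    · rw [Sym2.eq_iff] at hne
      rcases hne with ⟨-, rfl⟩ | ⟨-, rfl⟩
      · exact Or.inr (left_mem_edgeSide G _ a)
      · exact Or.inl (left_mem_edgeSide G _ b)
    · rcases ih with ih | ih
      · exact Or.inl (mem_edgeSide_of_adj h ih hne)
      · exact Or.inr (mem_edgeSide_of_adj h ih (by rwa [Sym2.eq_swap (a := b)]))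

/-- If `v ≠ w`, then the first edge `vb` of the path from `v` to `w` leads towards `w`. -/
theorem exists_adj_mem_edgeSide {ι : Type*} {G : SimpleGraph ι} (hG : G.IsTree) {v w : ι}
    (hne : v ≠ w) : ∃ b, G.Adj v b ∧ w ∈ edgeSide G b v ∧ G.dist b w < G.dist v w := by
  obtain ⟨p, hp, hlen⟩ := hG.connected.exists_path_of_dist v w
  cases p with
  | nil => exact absurd rfl hne
  | @cons _ b _ h p =>
    rw [SimpleGraph.Walk.cons_isPath_iff] at hp
    refine ⟨b, h, ?_, ?_⟩
    · refine SimpleGraph.Reachable.symm ⟨p.toDeleteEdges _ fun e he he' => ?_⟩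
      rw [Set.mem_singleton_iff] at he'
      subst he'
      exact hp.2 (SimpleGraph.Walk.snd_mem_support_of_mem_edges p he)
    · rw [← hlen, SimpleGraph.Walk.length_cons]
      exact Nat.lt_succ_of_le (SimpleGraph.dist_le p)

namespace GraphOfSubgroups

/-- The subgroup generated by the vertex groups on the side of `a` of the edge `ab`. -/
def sideGroup (Λ : GraphOfSubgroups W) (a b : Λ.ι) : Subgroup W :=
  ⨆ v ∈ edgeSide Λ.graph a b, Λ.vert v

theorem vert_le_sideGroup (Λ : GraphOfSubgroups W) {a b v : Λ.ι}
    (hv : v ∈ edgeSide Λ.graph a b) : Λ.vert v ≤ Λ.sideGroup a b :=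
  le_iSup₂_of_le v hv le_rfl

variable {Λ : GraphOfSubgroups W} {H : Subgroup W}

theorem toAmbient_of (Λ : GraphOfSubgroups W) (v : Λ.ι) (g : Λ.vert v) :
    Λ.toAmbient (QuotientGroup.mk (Monoid.CoprodI.of g)) = g := by
  change (Monoid.CoprodI.lift fun x => (Λ.vert x).subtype) (Monoid.CoprodI.of g) = g
  simp

theorem toAmbient_range (Λ : GraphOfSubgroups W) : Λ.toAmbient.range = ⨆ v, Λ.vert v := by
  apply le_antisymm
  · rintro _ ⟨p, rfl⟩
    induction p using QuotientGroup.induction_on with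
    | H p =>
      induction p using Monoid.CoprodI.induction_on with
      | one =>
        rw [QuotientGroup.mk_one, map_one]
        exact one_mem _
      | of i m =>
        rw [toAmbient_of]
        exact (le_iSup Λ.vert i) m.2
      | mul x y hx hy =>
        rw [QuotientGroup.mk_mul, map_mul]
        exact mul_mem hx hy
  · refine iSup_le fun v w hw => ⟨QuotientGroup.mk (Monoid.CoprodI.of ⟨w, hw⟩), ?_⟩
    rw [toAmbient_of]

theorem IsDecompositionOf.iSup_vert (hΛ : Λ.IsDecompositionOf H) : ⨆ v, Λ.vert v = H := by
  rw [← toAmbient_range, hΛ.range_eq]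

theorem IsDecompositionOf.vert_le (hΛ : Λ.IsDecompositionOf H) (v : Λ.ι) : Λ.vert v ≤ H :=
  hΛ.iSup_vert ▸ le_iSup Λ.vert v

theorem IsDecompositionOf.edge_le_left (hΛ : Λ.IsDecompositionOf H) {a b : Λ.ι}
    (hab : Λ.graph.Adj a b) : Λ.edge a b ≤ Λ.sideGroup a b :=
  (hΛ.edge_le a b hab).trans (Λ.vert_le_sideGroup (left_mem_edgeSide _ _ _))

theorem IsDecompositionOf.edge_le_right (hΛ : Λ.IsDecompositionOf H) {a b : Λ.ι}
    (hab : Λ.graph.Adj a b) : Λ.edge a b ≤ Λ.sideGroup b a :=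
  hΛ.edge_symm a b hab ▸ hΛ.edge_le_left hab.symm

/-- A decomposition exhibits the group as the amalgamated product of the groups of the two sides
of any of its edges. -/
theorem IsDecompositionOf.amalgamHom_bijective (hΛ : Λ.IsDecompositionOf H) {a b : Λ.ι}
    (hab : Λ.graph.Adj a b) {K : Bool → Subgroup W} (hX : K false = Λ.sideGroup a b)
    (hY : K true = Λ.sideGroup b a) (hK : ∀ i, Λ.edge a b ≤ K i) :
    Function.Injective (amalgamHom hK) ∧ (amalgamHom hK).range = H := by
  let c : Λ.ι → Bool := fun v => decide (v ∈ edgeSide Λ.graph b a)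
  have hc : ∀ v, Λ.vert v ≤ K (c v) := by
    intro v
    by_cases hv : v ∈ edgeSide Λ.graph b a
    · simp only [c, hv, decide_true, hY]
      exact Λ.vert_le_sideGroup hv
    · simp only [c, hv, decide_false, hX]
      exact Λ.vert_le_sideGroup ((mem_edgeSide_or hΛ.isTree.connected a b v).resolve_right hv)
  have hadj : ∀ x y, Λ.graph.Adj x y → c x = c y ∨ Λ.edge x y ≤ Λ.edge a b := by
    intro x y hxy
    by_cases hne : s(x, y) = s(a, b)
    · right
      rw [Sym2.eq_iff] at hne
      rcases hne with ⟨rfl, rfl⟩ | ⟨rfl, rfl⟩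
      · exact le_rfl
      · exact (hΛ.edge_symm _ _ hxy).le
    · left
      have : x ∈ edgeSide Λ.graph b a ↔ y ∈ edgeSide Λ.graph b a :=
        ⟨fun h => mem_edgeSide_of_adj hxy h (by rwa [Sym2.eq_swap (a := b)]),
          fun h => mem_edgeSide_of_adj hxy.symm h
            (by rwa [Sym2.eq_swap (a := b), Sym2.eq_swap (a := y)])⟩
      simp only [c, this]
  have glue : ∀ (i j : Bool) (e : W) (hi : e ∈ K i) (hj : e ∈ K j),
      i = j ∨ e ∈ Λ.edge a b →
      Monoid.PushoutI.of (φ := amalgamIncl hK) i ⟨e, hi⟩ =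
        Monoid.PushoutI.of (φ := amalgamIncl hK) j ⟨e, hj⟩ := by
    rintro i j e hi hj (rfl | he)
    · rfl
    · exact (Monoid.PushoutI.of_apply_eq_base (amalgamIncl hK) i ⟨e, he⟩).trans
        (Monoid.PushoutI.of_apply_eq_base (amalgamIncl hK) j ⟨e, he⟩).symm
  let θ₀ : Monoid.CoprodI (fun x => Λ.vert x) →* Monoid.PushoutI (amalgamIncl hK) :=
    Monoid.CoprodI.lift fun v =>
      (Monoid.PushoutI.of (φ := amalgamIncl hK) (c v)).comp (Subgroup.inclusion (hc v))
  have hθ₀ : Subgroup.normalClosure Λ.relators ≤ θ₀.ker := by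
    apply Subgroup.normalClosure_le_normal
    rintro _ ⟨x, y, e, hx, hy, hxy, he, rfl⟩
    simp only [SetLike.mem_coe, MonoidHom.mem_ker, map_mul, map_inv, θ₀, Monoid.CoprodI.lift_of,
      MonoidHom.coe_comp, Function.comp_apply, mul_inv_eq_one]
    exact glue _ _ e (hc x hx) (hc y hy) ((hadj x y hxy).imp_right fun h => h he)
  let θ : Λ.FundamentalGroup →* Monoid.PushoutI (amalgamIncl hK) :=
    QuotientGroup.lift _ θ₀ fun r hr => hθ₀ hr
  have hθof : ∀ v (g : Λ.vert v), θ (QuotientGroup.mk (Monoid.CoprodI.of g)) =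
      Monoid.PushoutI.of (φ := amalgamIncl hK) (c v) ⟨g, hc v g.2⟩ := by
    intro v g
    change θ₀ (Monoid.CoprodI.of g) = _
    simp only [θ₀, Monoid.CoprodI.lift_of]
    rfl
  have hcomp : ∀ p, amalgamHom hK (θ p) = Λ.toAmbient p := by
    intro p
    induction p using QuotientGroup.induction_on with
    | H p =>
      induction p using Monoid.CoprodI.induction_on with
      | one => simp
      | of i m => rw [toAmbient_of, hθof, amalgamHom_of]
      | mul x y hx hy => rw [QuotientGroup.mk_mul, map_mul, map_mul, map_mul, hx, hy]
  have hfac : ∀ (i : Bool) (g : K i),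
      Monoid.PushoutI.of (φ := amalgamIncl hK) i g ∈ θ.range := by
    intro i
    have hside : K i = ⨆ v ∈ {v | c v = i}, Λ.vert v := by
      have hset : ∀ i, {v | c v = i} = if i then edgeSide Λ.graph b a else edgeSide Λ.graph a b := by
        rintro (_ | _)
        · ext v
          simp only [c, Set.mem_ofPred_eq, decide_eq_false_iff_not, Bool.false_eq_true, if_false]
          exact ⟨fun h => (mem_edgeSide_or hΛ.isTree.connected a b v).resolve_right h,
            disjoint_edgeSide hΛ.isTree hab⟩
        · ext v
          simp [c]
      rw [hset i]
      cases i
      · exact hX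
      · exact hY
    refine forall_mem_of_eq_iSup hside _ _ fun v hv w hw hw' => ?_
    have hv : c v = i := hv
    subst hv
    exact ⟨QuotientGroup.mk (Monoid.CoprodI.of ⟨w, hw⟩), hθof v ⟨w, hw⟩⟩
  have hsurj : Function.Surjective θ := by
    intro p
    change p ∈ θ.range
    induction p using Monoid.PushoutI.induction_on with
    | of i g => exact hfac i g
    | base h =>
      rw [← Monoid.PushoutI.of_apply_eq_base (amalgamIncl hK) true]
      exact hfac _ _
    | mul x y hx hy => exact mul_mem hx hy
  constructor
  · rw [injective_iff_map_eq_one]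
    intro p hp
    obtain ⟨p, rfl⟩ := hsurj p
    rw [hcomp] at hp
    rw [(injective_iff_map_eq_one _).1 hΛ.injective p hp, map_one]
  · rw [← hΛ.range_eq]
    ext w
    constructor
    · rintro ⟨p, rfl⟩
      obtain ⟨p, rfl⟩ := hsurj p
      exact ⟨p, (hcomp p).symm⟩
    · rintro ⟨p, rfl⟩
      exact ⟨θ p, hcomp p⟩

end GraphOfSubgroups

end Edge

section

variable {B : Type v} {W : Type u} [Group W] {M : CoxeterMatrix B}

/-! ### Visual decompositions as tree decompositions of the presentation diagram -/

namespace VisualGraph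

/-- `Φ` is a tree decomposition of the part of the presentation diagram spanned by `V`. -/
structure IsTreeDecomposition (M : CoxeterMatrix B) (Φ : VisualGraph B) (V : Set B) : Prop where
  finite : Finite Φ.ι
  isTree : Φ.graph.IsTree
  edge_symm : ∀ x y, Φ.graph.Adj x y → Φ.edge x y = Φ.edge y x
  edge_subset : ∀ x y, Φ.graph.Adj x y → Φ.edge x y ⊆ Φ.vert x
  vert_subset : ∀ x, Φ.vert x ⊆ V
  exists_mem_mem : ∀ s ∈ V, ∀ t ∈ V, M s t ≠ 0 → ∃ x, s ∈ Φ.vert x ∧ t ∈ Φ.vert x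
  connected : ∀ s x y, s ∈ Φ.vert x → s ∈ Φ.vert y →
    Relation.ReflTransGen (fun x y => Φ.graph.Adj x y ∧ s ∈ Φ.edge x y) x y

theorem IsTreeDecomposition.exists_mem {Φ : VisualGraph B} {V : Set B}
    (h : Φ.IsTreeDecomposition M V) {s : B} (hs : s ∈ V) : ∃ x, s ∈ Φ.vert x := by
  obtain ⟨x, hx, -⟩ := h.exists_mem_mem s hs s hs (by simp)
  exact ⟨x, hx⟩

variable {Φ : VisualGraph B} {V : Set B}

theorem mk_of_eq_mk_of_adj (Λ : GraphOfSubgroups W) {x y : Λ.ι} (hxy : Λ.graph.Adj x y) {e : W}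
    (he : e ∈ Λ.edge x y) (hx : e ∈ Λ.vert x) (hy : e ∈ Λ.vert y) :
    (QuotientGroup.mk (Monoid.CoprodI.of (M := fun x => Λ.vert x) (i := x) ⟨e, hx⟩) :
      Λ.FundamentalGroup) =
      QuotientGroup.mk (Monoid.CoprodI.of (M := fun x => Λ.vert x) (i := y) ⟨e, hy⟩) := by
  have hr : Monoid.CoprodI.of (M := fun x => Λ.vert x) (i := x) ⟨e, hx⟩ *
      (Monoid.CoprodI.of (M := fun x => Λ.vert x) (i := y) ⟨e, hy⟩)⁻¹ ∈ Λ.relators :=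
    ⟨x, y, e, hx, hy, hxy, he, rfl⟩
  have h := (QuotientGroup.eq_one_iff _).2 (Subgroup.subset_normalClosure hr)
  rwa [QuotientGroup.mk_mul, QuotientGroup.mk_inv, mul_inv_eq_one] at h

theorem IsTreeDecomposition.mk_of_eq_mk_of (h : Φ.IsTreeDecomposition M V)
    (cs : CoxeterSystem M W) {s : B} {x y : Φ.ι} (hx : s ∈ Φ.vert x) (hy : s ∈ Φ.vert y) :
    (QuotientGroup.mk (Monoid.CoprodI.of (M := fun x => (Φ.toGraph cs).vert x) (i := x)
      ⟨cs.simple s, simple_mem_visualSubgroup cs hx⟩) : (Φ.toGraph cs).FundamentalGroup) =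
      QuotientGroup.mk (Monoid.CoprodI.of (M := fun x => (Φ.toGraph cs).vert x) (i := y)
        ⟨cs.simple s, simple_mem_visualSubgroup cs hy⟩) := by
  have key := h.connected s x y hx hy
  revert hy
  induction key with
  | refl => intro _; rfl
  | @tail z y _ hzy ih =>
    intro hy
    have hz := h.edge_subset _ _ hzy.1 hzy.2
    rw [ih hz]
    exact mk_of_eq_mk_of_adj (Φ.toGraph cs) (x := z) (y := y) hzy.1
      (simple_mem_visualSubgroup cs hzy.2) _ _

theorem IsTreeDecomposition.iSup_vert (h : Φ.IsTreeDecomposition M V) (cs : CoxeterSystem M W) :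
    ⨆ x, (Φ.toGraph cs).vert x = visualSubgroup cs V := by
  apply le_antisymm
  · exact iSup_le fun x => visualSubgroup_mono cs (h.vert_subset x)
  · refine visualSubgroup_le_of_forall cs fun s hs => ?_
    obtain ⟨x, hx⟩ := h.exists_mem hs
    exact le_iSup (Φ.toGraph cs).vert x (simple_mem_visualSubgroup cs hx)

theorem IsTreeDecomposition.isDecompositionOf (h : Φ.IsTreeDecomposition M V)
    (cs : CoxeterSystem M W) : (Φ.toGraph cs).IsDecompositionOf (visualSubgroup cs V) := by
  have hrange : (Φ.toGraph cs).toAmbient.range = visualSubgroup cs V := by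
    rw [GraphOfSubgroups.toAmbient_range, h.iSup_vert cs]
  refine ⟨h.finite, h.isTree, fun x y hxy => congrArg (visualSubgroup cs) (h.edge_symm x y hxy),
    fun x y hxy => visualSubgroup_mono cs (h.edge_subset x y hxy), ?_, hrange⟩
  choose c hc using fun s : V => h.exists_mem s.2
  let gen (x : Φ.ι) (w : (Φ.toGraph cs).vert x) : (Φ.toGraph cs).FundamentalGroup :=
    QuotientGroup.mk (Monoid.CoprodI.of (M := fun x => (Φ.toGraph cs).vert x) (i := x) w)
  have gen_mul : ∀ x w w', gen x (w * w') = gen x w * gen x w' := fun x w w' => by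
    simp only [gen, map_mul, QuotientGroup.mk_mul]
  have gen_one : ∀ x, gen x 1 = 1 := fun x => by
    simp only [gen, map_one, QuotientGroup.mk_one]
  have gen_inv : ∀ x w, gen x w⁻¹ = (gen x w)⁻¹ := fun x w => by
    simp only [gen, map_inv, QuotientGroup.mk_inv]
  have gen_pow : ∀ x w (n : ℕ), gen x (w ^ n) = gen x w ^ n := fun x w n => by
    simp only [gen, map_pow, QuotientGroup.mk_pow]
  let f (s : V) : (Φ.toGraph cs).FundamentalGroup :=
    gen (c s) ⟨cs.simple s, simple_mem_visualSubgroup cs (hc s)⟩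
  have hfgen : ∀ (s : V) x (hx : (s : B) ∈ Φ.vert x),
      f s = gen x ⟨cs.simple s, simple_mem_visualSubgroup cs hx⟩ :=
    fun s x hx => h.mk_of_eq_mk_of cs (hc s) hx
  obtain ⟨F, hF⟩ := exists_hom_visualSubgroup cs V f (by
    intro a b
    by_cases hab : M a b = 0
    · rw [hab, pow_zero]
    · obtain ⟨x, hax, hbx⟩ := h.exists_mem_mem a a.2 b b.2 hab
      rw [hfgen a x hax, hfgen b x hbx, ← gen_mul, ← gen_pow, ← gen_one x]
      congr 1
      exact Subtype.ext (cs.simple_mul_simple_pow a b))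
  have hFgen : ∀ x w (hw : w ∈ (Φ.toGraph cs).vert x) (hw' : w ∈ visualSubgroup cs V),
      F ⟨w, hw'⟩ = gen x ⟨w, hw⟩ := by
    intro x w hw
    have hw₀ : w ∈ visualSubgroup cs (Φ.vert x) := hw
    unfold visualSubgroup at hw₀
    induction hw₀ using Subgroup.closure_induction with
    | mem w hw₁ =>
      obtain ⟨s, hs, rfl⟩ := hw₁
      intro hw'
      exact (hF ⟨s, h.vert_subset x hs⟩).trans (hfgen _ x hs)
    | one =>
      intro hw'
      exact (map_one F).trans (gen_one x).symm
    | mul w w' hw₁ hw₂ ih ih' =>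
      intro hw'
      have m₁ := visualSubgroup_mono cs (h.vert_subset x) hw₁
      have m₂ := visualSubgroup_mono cs (h.vert_subset x) hw₂
      have := gen_mul x ⟨w, hw₁⟩ ⟨w', hw₂⟩
      rw [← ih hw₁ m₁, ← ih' hw₂ m₂, ← map_mul] at this
      exact this.symm
    | inv w hw₁ ih =>
      intro hw'
      have m₁ := visualSubgroup_mono cs (h.vert_subset x) hw₁
      have := gen_inv x ⟨w, hw₁⟩
      rw [← ih hw₁ m₁, ← map_inv] at this
      exact this.symm
  have hinv : ∀ p (hp : (Φ.toGraph cs).toAmbient p ∈ visualSubgroup cs V),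
      F ⟨(Φ.toGraph cs).toAmbient p, hp⟩ = p := by
    intro p
    have hmem : ∀ p, (Φ.toGraph cs).toAmbient p ∈ visualSubgroup cs V :=
      fun p => hrange ▸ ⟨p, rfl⟩
    induction p using QuotientGroup.induction_on with
    | H p =>
      induction p using Monoid.CoprodI.induction_on with
      | one =>
        intro hp
        have : (⟨(Φ.toGraph cs).toAmbient (QuotientGroup.mk 1), hp⟩ : visualSubgroup cs V) = 1 :=
          Subtype.ext (by simp)
        rw [this, map_one, QuotientGroup.mk_one]
      | of x w =>
        intro hp
        have := GraphOfSubgroups.toAmbient_of (Φ.toGraph cs) x w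
        simp only [this]
        exact hFgen x w w.2 _
      | mul a b ha hb =>
        intro hp
        have : (⟨(Φ.toGraph cs).toAmbient (QuotientGroup.mk (a * b)), hp⟩ : visualSubgroup cs V) =
          ⟨_, hmem (QuotientGroup.mk a)⟩ * ⟨_, hmem (QuotientGroup.mk b)⟩ :=
          Subtype.ext (by simp)
        rw [this, map_mul, ha, hb, QuotientGroup.mk_mul]
  intro p q hpq
  have hp : (Φ.toGraph cs).toAmbient p ∈ visualSubgroup cs V := hrange ▸ ⟨p, rfl⟩
  have hq : (Φ.toGraph cs).toAmbient q ∈ visualSubgroup cs V := hrange ▸ ⟨q, rfl⟩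
  rw [← hinv p hp, ← hinv q hq]
  congr 1
  exact Subtype.ext hpq

/-- The union of the vertices on the side of `a` of the edge `ab`. -/
def sideSet (Φ : VisualGraph B) (a b : Φ.ι) : Set B :=
  {s | ∃ x ∈ edgeSide Φ.graph a b, s ∈ Φ.vert x}

theorem sideGroup_toGraph (Φ : VisualGraph B) (cs : CoxeterSystem M W) (a b : Φ.ι) :
    (Φ.toGraph cs).sideGroup a b = visualSubgroup cs (Φ.sideSet a b) := by
  apply le_antisymm
  · exact iSup₂_le fun x hx => visualSubgroup_mono cs fun s hs => ⟨x, hx, hs⟩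
  · refine visualSubgroup_le_of_forall cs ?_
    rintro s ⟨x, hx, hs⟩
    exact (Φ.toGraph cs).vert_le_sideGroup hx (simple_mem_visualSubgroup cs hs)

theorem vert_subset_sideSet (Φ : VisualGraph B) {a b x : Φ.ι} (hx : x ∈ edgeSide Φ.graph a b) :
    Φ.vert x ⊆ Φ.sideSet a b := fun _ hs => ⟨x, hx, hs⟩

section Decomposition

variable {cs : CoxeterSystem M W}

theorem isTree_of_decomposition
    (h : (Φ.toGraph cs).IsDecompositionOf (visualSubgroup cs V)) : Φ.graph.IsTree := h.isTree

theorem vert_subset_of_decomposition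
    (h : (Φ.toGraph cs).IsDecompositionOf (visualSubgroup cs V))
    (x : Φ.ι) : Φ.vert x ⊆ V :=
  (visualSubgroup_le_iff cs).1 (h.vert_le x)

theorem edge_symm_of_decomposition
    (h : (Φ.toGraph cs).IsDecompositionOf (visualSubgroup cs V))
    {a b : Φ.ι} (hab : Φ.graph.Adj a b) :
    Φ.edge a b = Φ.edge b a :=
  visualSubgroup_injective cs (h.edge_symm a b hab)

theorem edge_subset_of_decomposition
    (h : (Φ.toGraph cs).IsDecompositionOf (visualSubgroup cs V))
    {a b : Φ.ι} (hab : Φ.graph.Adj a b) :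
    Φ.edge a b ⊆ Φ.vert a :=
  (visualSubgroup_le_iff cs).1 (h.edge_le a b hab)

theorem exists_mem_of_decomposition
    (h : (Φ.toGraph cs).IsDecompositionOf (visualSubgroup cs V))
    {s : B} (hs : s ∈ V) : ∃ x, s ∈ Φ.vert x := by
  have h1 : ⨆ x, (Φ.toGraph cs).vert x ≤ visualSubgroup cs {s | ∃ x, s ∈ Φ.vert x} :=
    iSup_le fun x => visualSubgroup_mono cs fun s hs => ⟨x, hs⟩
  rw [h.iSup_vert] at h1
  exact (visualSubgroup_le_iff cs).1 h1 hs

theorem sideSet_union_of_decomposition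
    (h : (Φ.toGraph cs).IsDecompositionOf (visualSubgroup cs V))
    (a b : Φ.ι) :
    Φ.sideSet a b ∪ Φ.sideSet b a = V := by
  ext s
  constructor
  · rintro (⟨x, -, hx⟩ | ⟨x, -, hx⟩) <;> exact vert_subset_of_decomposition h x hx
  · intro hs
    obtain ⟨x, hx⟩ := exists_mem_of_decomposition h hs
    rcases mem_edgeSide_or h.isTree.connected a b x with hx' | hx'
    · exact Or.inl ⟨x, hx', hx⟩
    · exact Or.inr ⟨x, hx', hx⟩

theorem amalgamHom_visual_bijective
    (h : (Φ.toGraph cs).IsDecompositionOf (visualSubgroup cs V))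
    {a b : Φ.ι} (hab : Φ.graph.Adj a b)
    {K : Bool → Subgroup W} (hX : K false = visualSubgroup cs (Φ.sideSet a b))
    (hY : K true = visualSubgroup cs (Φ.sideSet b a))
    (hK : ∀ i, visualSubgroup cs (Φ.edge a b) ≤ K i) :
    Function.Injective (amalgamHom hK) ∧ (amalgamHom hK).range = visualSubgroup cs V :=
  h.amalgamHom_bijective hab (hX.trans (sideGroup_toGraph Φ cs a b).symm)
    (hY.trans (sideGroup_toGraph Φ cs b a).symm) hK

theorem edge_le_sides
    (h : (Φ.toGraph cs).IsDecompositionOf (visualSubgroup cs V))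
    {a b : Φ.ι} (hab : Φ.graph.Adj a b) (i : Bool) :
    visualSubgroup cs (Φ.edge a b) ≤
      (bif i then visualSubgroup cs (Φ.sideSet b a) else visualSubgroup cs (Φ.sideSet a b)) := by
  have h1 := h.edge_le_left hab
  have h2 := h.edge_le_right hab
  cases i
  · exact h1.trans (sideGroup_toGraph Φ cs a b).le
  · exact h2.trans (sideGroup_toGraph Φ cs b a).le

theorem sideSet_inter_of_decomposition
    (h : (Φ.toGraph cs).IsDecompositionOf (visualSubgroup cs V))
    {a b : Φ.ι} (hab : Φ.graph.Adj a b) :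
    Φ.sideSet a b ∩ Φ.sideSet b a = Φ.edge a b := by
  apply Set.Subset.antisymm
  · rintro s ⟨ha, hb⟩
    have := inf_le_of_amalgamHom_injective (edge_le_sides h hab)
      (amalgamHom_visual_bijective h hab rfl rfl _).1 (show false ≠ true by simp)
      (show cs.simple s ∈ _ from ⟨simple_mem_visualSubgroup cs ha, simple_mem_visualSubgroup cs hb⟩)
    exact (simple_mem_visualSubgroup_iff cs).1 this
  · intro s hs
    exact ⟨⟨a, left_mem_edgeSide _ _ _, edge_subset_of_decomposition h hab hs⟩,
      ⟨b, left_mem_edgeSide _ _ _, edge_subset_of_decomposition h hab.symm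
        (edge_symm_of_decomposition h hab ▸ hs)⟩⟩

/-- There is no edge of the presentation diagram across an edge of a visual decomposition. -/
theorem eq_zero_of_mem_sideSet
    (h : (Φ.toGraph cs).IsDecompositionOf (visualSubgroup cs V))
    {a b : Φ.ι} (hab : Φ.graph.Adj a b) {s t : B}
    (hs : s ∈ Φ.sideSet a b) (hsE : s ∉ Φ.edge a b) (ht : t ∈ Φ.sideSet b a)
    (htE : t ∉ Φ.edge a b) : M s t = 0 := by
  by_contra hne
  exact mul_pow_ne_one_of_amalgamHom_injective (edge_le_sides h hab)
    (amalgamHom_visual_bijective h hab rfl rfl _).1 (show false ≠ true by simp)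
    (simple_mem_visualSubgroup cs hs) (by simpa using hsE) (simple_mem_visualSubgroup cs ht)
    (by simpa using htE) hne (cs.simple_mul_simple_pow s t)

/-- A set of generators that is elliptic in a visual decomposition is not separated by any
of its edges. -/
theorem subset_sideSet_of_le_conjSubgroup
    (h : (Φ.toGraph cs).IsDecompositionOf (visualSubgroup cs V))
    {a b : Φ.ι} (hab : Φ.graph.Adj a b) {R : Set B}
    (hR : R ⊆ V) {k : W} (hk : k ∈ visualSubgroup cs V) {x : Φ.ι}
    (hle : visualSubgroup cs R ≤ conjSubgroup k (visualSubgroup cs (Φ.vert x))) :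
    R ⊆ Φ.sideSet a b ∨ R ⊆ Φ.sideSet b a := by
  by_contra! hcon
  obtain ⟨hna, hnb⟩ := hcon
  obtain ⟨t, htR, hta⟩ := Set.not_subset.1 hna
  obtain ⟨s, hsR, hsb⟩ := Set.not_subset.1 hnb
  have hu := sideSet_union_of_decomposition h a b
  have hi := sideSet_inter_of_decomposition h hab
  have ht : t ∈ Φ.sideSet b a := (hu.ge (hR htR)).resolve_left hta
  have hs : s ∈ Φ.sideSet a b := (hu.ge (hR hsR)).resolve_right hsb
  have htE : t ∉ Φ.edge a b := fun h' => hta (hi.ge h').1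
  have hsE : s ∉ Φ.edge a b := fun h' => hsb (hi.ge h').2
  have hbij := amalgamHom_visual_bijective h hab rfl rfl (edge_le_sides h hab)
  have key := mul_notMem_conjSubgroup_of_amalgamHom_injective (edge_le_sides h hab) hbij.1
    (show false ≠ true by simp) (simple_mem_visualSubgroup cs hs) (by simpa using hsE)
    (simple_mem_visualSubgroup cs ht) (by simpa using htE) (hbij.2.ge hk)
  have hst := hle (mul_mem (simple_mem_visualSubgroup cs hsR) (simple_mem_visualSubgroup cs htR))
  rcases mem_edgeSide_or h.isTree.connected a b x with hx | hx
  · exact key false (conjSubgroup_mono k (visualSubgroup_mono cs (Φ.vert_subset_sideSet hx)) hst)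
  · exact key true (conjSubgroup_mono k (visualSubgroup_mono cs (Φ.vert_subset_sideSet hx)) hst)

/-- If no edge separates `R`, then a vertex can be enlarged within `R` by any element of `R`. -/
theorem exists_insert_subset_vert
    (h : (Φ.toGraph cs).IsDecompositionOf (visualSubgroup cs V))
    {R : Set B}
    (hR : ∀ a b, Φ.graph.Adj a b → R ⊆ Φ.sideSet a b ∨ R ⊆ Φ.sideSet b a) {Q : Set B} (hQR : Q ⊆ R)
    {s : B} (hs : s ∈ R) {x y : Φ.ι} (hx : Q ⊆ Φ.vert x) (hy : s ∈ Φ.vert y) :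
    ∃ z, insert s Q ⊆ Φ.vert z := by
  induction hn : Φ.graph.dist x y using Nat.strong_induction_on generalizing x with
  | _ n ih =>
    by_cases hsx : s ∈ Φ.vert x
    · exact ⟨x, Set.insert_subset hsx hx⟩
    have hne : x ≠ y := fun h' => hsx (h' ▸ hy)
    obtain ⟨b, hxb, hyb, hlt⟩ := exists_adj_mem_edgeSide (isTree_of_decomposition h) hne
    have hi := sideSet_inter_of_decomposition h hxb
    have hsb : s ∈ Φ.sideSet b x := ⟨y, hyb, hy⟩
    have hRb : R ⊆ Φ.sideSet b x := by
      refine (hR x b hxb).resolve_left fun hRx => hsx ?_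
      exact edge_subset_of_decomposition h hxb (hi.le ⟨hRx hs, hsb⟩)
    refine ih _ (hn ▸ hlt) (x := b) (fun q hq => ?_) rfl
    have : q ∈ Φ.edge x b :=
      hi.le ⟨Φ.vert_subset_sideSet (left_mem_edgeSide _ _ _) (hx hq), hRb (hQR hq)⟩
    rw [edge_symm_of_decomposition h hxb] at this
    exact edge_subset_of_decomposition h hxb.symm this

/-- A set of generators that is not separated by any edge lies in a vertex. -/
theorem exists_subset_vert_of_forall
    (h : (Φ.toGraph cs).IsDecompositionOf (visualSubgroup cs V))
    [Finite B] {R : Set B} (hRV : R ⊆ V)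
    (hR : ∀ a b, Φ.graph.Adj a b → R ⊆ Φ.sideSet a b ∨ R ⊆ Φ.sideSet b a) :
    ∃ x, R ⊆ Φ.vert x := by
  suffices ∀ Q ⊆ R, ∃ x, Q ⊆ Φ.vert x from this R subset_rfl
  intro Q hQR
  induction Q, Q.toFinite using Set.Finite.induction_on with
  | empty =>
    obtain ⟨x⟩ := (isTree_of_decomposition h).connected.nonempty
    exact ⟨x, Set.empty_subset _⟩
  | @insert s Q _ _ ih =>
    rw [Set.insert_subset_iff] at hQR
    obtain ⟨x, hx⟩ := ih hQR.2
    obtain ⟨y, hy⟩ := exists_mem_of_decomposition h (hRV hQR.1)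
    exact exists_insert_subset_vert h hR hQR.2 hQR.1 hx hy

theorem exists_subset_vert_of_le_conjSubgroup
    (h : (Φ.toGraph cs).IsDecompositionOf (visualSubgroup cs V))
    [Finite B] {R : Set B} (hR : R ⊆ V) {k : W}
    (hk : k ∈ visualSubgroup cs V) {x : Φ.ι}
    (hle : visualSubgroup cs R ≤ conjSubgroup k (visualSubgroup cs (Φ.vert x))) :
    ∃ x, R ⊆ Φ.vert x :=
  exists_subset_vert_of_forall h hR fun _ _ hab => subset_sideSet_of_le_conjSubgroup h hab hR hk hle

theorem isTreeDecomposition_of_decomposition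
    (h : (Φ.toGraph cs).IsDecompositionOf (visualSubgroup cs V))
    [Finite B] : Φ.IsTreeDecomposition M V where
  finite := h.finite
  isTree := h.isTree
  edge_symm _ _ := edge_symm_of_decomposition h
  edge_subset _ _ := edge_subset_of_decomposition h
  vert_subset := vert_subset_of_decomposition h
  exists_mem_mem s hs t ht hst := by
    obtain ⟨x, hx⟩ := exists_subset_vert_of_forall h (R := {s, t})
      (Set.insert_subset hs (Set.singleton_subset_iff.2 ht)) fun a b hab => by
        have hu := sideSet_union_of_decomposition h a b
        have hi := sideSet_inter_of_decomposition h hab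
        by_contra! hcon
        simp only [Set.insert_subset_iff, Set.singleton_subset_iff] at hcon
        have hs' := hu.ge hs
        have ht' := hu.ge ht
        have h1 := eq_zero_of_mem_sideSet h hab (s := s) (t := t)
        have h2 := eq_zero_of_mem_sideSet h hab (s := t) (t := s)
        rw [M.symmetric t s] at h2
        rw [← hi] at h1 h2
        simp only [Set.mem_union, Set.mem_inter_iff] at *
        tauto
    exact ⟨x, hx (by simp), hx (by simp)⟩
  connected s x y hx hy := by
    induction hn : Φ.graph.dist x y using Nat.strong_induction_on generalizing x with
    | _ n ih =>
      by_cases hne : x = y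
      · subst hne; exact .refl
      obtain ⟨b, hxb, hyb, hlt⟩ := exists_adj_mem_edgeSide (isTree_of_decomposition h) hne
      have hs : s ∈ Φ.edge x b := (sideSet_inter_of_decomposition h hxb).le
        ⟨⟨x, left_mem_edgeSide _ _ _, hx⟩, ⟨y, hyb, hy⟩⟩
      refine .head ⟨hxb, hs⟩ (ih _ (hn ▸ hlt) b ?_ rfl)
      rw [edge_symm_of_decomposition h hxb] at hs
      exact edge_subset_of_decomposition h hxb.symm hs

end Decomposition

end VisualGraph

end

/-! ### Graph operations that preserve trees -/

section Graphs

open GraphOfSubgroups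

variable {ι : Type} {G : SimpleGraph ι}

theorem isTree_of_card_edgeSet_le {κ : Type*} [Finite κ] {G : SimpleGraph κ} (hG : G.Connected)
    (h : Nat.card G.edgeSet + 1 ≤ Nat.card κ) : G.IsTree :=
  SimpleGraph.isTree_iff_connected_and_card.2
    ⟨hG, le_antisymm h hG.card_vert_le_card_edgeSet_add_one⟩

/-- The underlying graph of a refinement at `u`. -/
def refineGraph (G : SimpleGraph ι) (u : ι) (side : ι → Bool) : SimpleGraph (Option ι) :=
  SimpleGraph.fromRel fun p q =>
    (p = some u ∧ q = none) ∨
      (G.Adj (refineProj u p) (refineProj u q) ∧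
        p = refineAttach u side (refineProj u p) (refineProj u q) ∧
        q = refineAttach u side (refineProj u q) (refineProj u p))

@[simp]
theorem refineProj_refineAttach (u : ι) (side : ι → Bool) (x y : ι) :
    refineProj u (refineAttach u side x y) = x := by
  unfold refineAttach
  split_ifs with h h'
  · exact h.symm
  · exact h.symm
  · rfl

theorem refineGraph_adj (u : ι) (side : ι → Bool) (p q : Option ι) :
    (refineGraph G u side).Adj p q ↔ (p = some u ∧ q = none) ∨ (p = none ∧ q = some u) ∨
      (G.Adj (refineProj u p) (refineProj u q) ∧
        p = refineAttach u side (refineProj u p) (refineProj u q) ∧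
        q = refineAttach u side (refineProj u q) (refineProj u p)) := by
  rw [refineGraph, SimpleGraph.fromRel_adj]
  constructor
  · rintro ⟨-, (h | h) | (h | ⟨h1, h2, h3⟩)⟩
    · exact Or.inl h
    · exact Or.inr (Or.inr h)
    · exact Or.inr (Or.inl ⟨h.2, h.1⟩)
    · exact Or.inr (Or.inr ⟨h1.symm, h3, h2⟩)
  · rintro (⟨rfl, rfl⟩ | ⟨rfl, rfl⟩ | h)
    · exact ⟨by simp, Or.inl (Or.inl ⟨rfl, rfl⟩)⟩
    · exact ⟨by simp, Or.inr (Or.inl ⟨rfl, rfl⟩)⟩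
    · exact ⟨fun hpq => h.1.ne (by rw [hpq]), Or.inl (Or.inr h)⟩

theorem refineGraph_adj_attach (u : ι) (side : ι → Bool) {x y : ι} (h : G.Adj x y) :
    (refineGraph G u side).Adj (refineAttach u side x y) (refineAttach u side y x) := by
  rw [refineGraph_adj]
  exact Or.inr (Or.inr (by simpa using h))

theorem eq_or_of_refineProj_eq {u : ι} {p q : Option ι} (h : refineProj u p = refineProj u q) :
    p = q ∨ (p = some u ∧ q = none) ∨ (p = none ∧ q = some u) := by
  cases p <;> cases q <;> simp_all [refineProj]

theorem refineGraph_reachable_of_proj_eq (G : SimpleGraph ι) {u : ι} (side : ι → Bool)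
    {p q : Option ι} (h : refineProj u p = refineProj u q) :
    (refineGraph G u side).Reachable p q := by
  rcases eq_or_of_refineProj_eq h with rfl | h' | h'
  · exact .refl _
  · exact SimpleGraph.Adj.reachable ((refineGraph_adj u side p q).2 (Or.inl h'))
  · exact SimpleGraph.Adj.reachable ((refineGraph_adj u side p q).2 (Or.inr (Or.inl h')))

theorem refineGraph_connected (hG : G.Connected) (u : ι) (side : ι → Bool) :
    (refineGraph G u side).Connected := by
  have : Nonempty (Option ι) := ⟨none⟩
  refine SimpleGraph.Connected.mk fun p q => ?_
  have key : ∀ {x y : ι}, G.Walk x y →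
      (refineGraph G u side).Reachable (some x) (some y) := by
    intro x y w
    induction w with
    | nil => exact .refl _
    | @cons x y _ h _ ih =>
      refine SimpleGraph.Reachable.trans ?_ ih
      exact (refineGraph_reachable_of_proj_eq G side (by rw [refineProj_refineAttach]; rfl)).trans
        ((refineGraph_adj_attach u side h).reachable.trans
          (refineGraph_reachable_of_proj_eq G side (by rw [refineProj_refineAttach]; rfl)))
  obtain ⟨w⟩ := hG.preconnected (refineProj u p) (refineProj u q)
  have hp : (refineGraph G u side).Reachable p (some (refineProj u p)) :=
    refineGraph_reachable_of_proj_eq G side rfl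
  have hq : (refineGraph G u side).Reachable (some (refineProj u q)) q :=
    refineGraph_reachable_of_proj_eq G side rfl
  exact hp.trans ((key w).trans hq)

theorem refineGraph_isTree [Finite ι] (hG : G.IsTree) (u : ι) (side : ι → Bool) :
    (refineGraph G u side).IsTree := by
  apply isTree_of_card_edgeSet_le (refineGraph_connected hG.connected u side)
  let L : Sym2 ι → Sym2 (Option ι) := Sym2.lift
    ⟨fun x y => s(refineAttach u side x y, refineAttach u side y x), fun x y => Sym2.eq_swap⟩
  have hsub : (refineGraph G u side).edgeSet ⊆ insert s(some u, none) (L '' G.edgeSet) := by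
    intro e
    induction e with
    | h p q =>
      rw [SimpleGraph.mem_edgeSet, refineGraph_adj]
      rintro (⟨rfl, rfl⟩ | ⟨rfl, rfl⟩ | ⟨h, hp, hq⟩)
      · exact Or.inl rfl
      · exact Or.inl Sym2.eq_swap
      · refine Or.inr ⟨s(refineProj u p, refineProj u q), h, ?_⟩
        simp only [L, Sym2.lift_mk]
        rw [← hp, ← hq]
  have h1 := Set.ncard_le_ncard hsub
  have h2 := Set.ncard_insert_le s(some u, none) (L '' G.edgeSet)
  have h3 : (L '' G.edgeSet).ncard ≤ G.edgeSet.ncard := Set.ncard_image_le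
  have h4 := (SimpleGraph.isTree_iff_connected_and_card.1 hG).2
  rw [Finite.card_option, ← h4, Nat.card_coe_set_eq, Nat.card_coe_set_eq]
  omega

/-- The underlying graph after collapsing the edge `ab`. -/
def collapseGraph (G : SimpleGraph ι) (a b : ι) : SimpleGraph {x : ι // x ≠ a} :=
  SimpleGraph.fromRel fun x y => G.Adj x.1 y.1 ∨ (x.1 = b ∧ G.Adj a y.1)

/-- The vertex into which a vertex is absorbed when `a` is collapsed into `b`. -/
def collapseProj (a b : ι) (hab : a ≠ b) (x : ι) : {x : ι // x ≠ a} :=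
  if h : x = a then ⟨b, hab.symm⟩ else ⟨x, h⟩

theorem collapseProj_of_ne {a b : ι} (hab : a ≠ b) {x : ι} (h : x ≠ a) :
    collapseProj a b hab x = ⟨x, h⟩ := by simp [collapseProj, h]

@[simp]
theorem collapseProj_coe {a b : ι} (hab : a ≠ b) (x : {x : ι // x ≠ a}) :
    collapseProj a b hab x = x := collapseProj_of_ne hab x.2

@[simp]
theorem collapseProj_self {a b : ι} (hab : a ≠ b) :
    collapseProj a b hab a = ⟨b, hab.symm⟩ := by simp [collapseProj]

theorem collapseGraph_adj (a b : ι) (x y : {x : ι // x ≠ a}) :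
    (collapseGraph G a b).Adj x y ↔ G.Adj x.1 y.1 ∨
      (x ≠ y ∧ ((x.1 = b ∧ G.Adj a y.1) ∨ (y.1 = b ∧ G.Adj a x.1))) := by
  rw [collapseGraph, SimpleGraph.fromRel_adj]
  have h1 : G.Adj y.1 x.1 ↔ G.Adj x.1 y.1 := G.adj_comm _ _
  have h2 : G.Adj x.1 y.1 → x ≠ y := fun h e => h.ne (by rw [e])
  tauto

theorem collapseGraph_adj_proj {a b : ι} (hab : a ≠ b) {x y : ι} (h : G.Adj x y) :
    collapseProj a b hab x = collapseProj a b hab y ∨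
      (collapseGraph G a b).Adj (collapseProj a b hab x) (collapseProj a b hab y) := by
  by_cases hxy : collapseProj a b hab x = collapseProj a b hab y
  · exact Or.inl hxy
  right
  rw [collapseGraph_adj]
  by_cases hx : x = a
  · subst hx
    have hy : y ≠ x := h.ne'
    rw [collapseProj_of_ne hab hy, collapseProj_self] at hxy ⊢
    exact Or.inr ⟨hxy, Or.inl ⟨rfl, h⟩⟩
  · by_cases hy : y = a
    · subst hy
      rw [collapseProj_of_ne hab hx, collapseProj_self] at hxy ⊢
      exact Or.inr ⟨hxy, Or.inr ⟨rfl, h.symm⟩⟩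
    · rw [collapseProj_of_ne hab hx, collapseProj_of_ne hab hy]
      exact Or.inl h

theorem collapseGraph_connected (hG : G.Connected) {a b : ι} (hab : a ≠ b) :
    (collapseGraph G a b).Connected := by
  have : Nonempty {x : ι // x ≠ a} := ⟨⟨b, hab.symm⟩⟩
  refine SimpleGraph.Connected.mk fun p q => ?_
  have key : ∀ {x y : ι}, G.Walk x y →
      (collapseGraph G a b).Reachable (collapseProj a b hab x) (collapseProj a b hab y) := by
    intro x y w
    induction w with
    | nil => exact .refl _
    | @cons x y _ h _ ih =>
      rcases collapseGraph_adj_proj hab h with h' | h'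
      · rw [h']; exact ih
      · exact h'.reachable.trans ih
  obtain ⟨w⟩ := hG.preconnected p.1 q.1
  have := key w
  rwa [collapseProj_coe, collapseProj_coe] at this

theorem collapseGraph_isTree [Finite ι] (hG : G.IsTree) {a b : ι} (hab : G.Adj a b) :
    (collapseGraph G a b).IsTree := by
  apply isTree_of_card_edgeSet_le (collapseGraph_connected hG.connected hab.ne)
  have hsub : (collapseGraph G a b).edgeSet ⊆
      Sym2.map (collapseProj a b hab.ne) '' (G.edgeSet \ {s(a, b)}) := by
    intro e
    induction e with
    | h x y =>
      rw [SimpleGraph.mem_edgeSet, collapseGraph_adj]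
      rintro (h | ⟨hne, ⟨hx, h⟩ | ⟨hy, h⟩⟩)
      · refine ⟨s(x.1, y.1), ⟨h, ?_⟩, by simp⟩
        rw [Set.mem_singleton_iff, Sym2.eq_iff]
        rintro (h' | h')
        · exact x.2 h'.1
        · exact y.2 h'.2
      · have hyb : y.1 ≠ b := fun h' => hne (Subtype.ext (hx.trans h'.symm))
        refine ⟨s(a, y.1), ⟨h, ?_⟩, ?_⟩
        · rw [Set.mem_singleton_iff, Sym2.eq_iff]
          rintro (h' | h')
          · exact hyb h'.2
          · exact y.2 h'.2
        · simp [← hx]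
      · have hxb : x.1 ≠ b := fun h' => hne (Subtype.ext (h'.trans hy.symm))
        refine ⟨s(a, x.1), ⟨h, ?_⟩, ?_⟩
        · rw [Set.mem_singleton_iff, Sym2.eq_iff]
          rintro (h' | h')
          · exact hxb h'.2
          · exact x.2 h'.2
        · simp [← hy, Sym2.eq_swap]
  have h1 := Set.ncard_le_ncard hsub
  have h3 : (Sym2.map (collapseProj a b hab.ne) '' (G.edgeSet \ {s(a, b)})).ncard ≤
    (G.edgeSet \ {s(a, b)}).ncard := Set.ncard_image_le
  have h4 := (SimpleGraph.isTree_iff_connected_and_card.1 hG).2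
  have h5 := Set.ncard_sdiff_singleton_add_one (s := G.edgeSet) (a := s(a, b)) hab
  have h6 : Nat.card {x : ι // x ≠ a} + 1 = Nat.card ι := by
    have := Set.ncard_add_ncard_compl ({a} : Set ι)
    rw [Set.ncard_singleton, ← Nat.card_coe_set_eq ({a}ᶜ : Set ι)] at this
    rw [← this, add_comm]
    rfl
  rw [Nat.card_coe_set_eq] at h4 ⊢
  omega

theorem not_adj_of_isTree {κ : Type*} {G : SimpleGraph κ} (hG : G.IsTree) {a b c : κ}
    (hab : G.Adj a b) (hac : G.Adj a c) : ¬ G.Adj b c := fun hbc =>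
  hG.isAcyclic.cliqueFree le_rfl {a, b, c} (SimpleGraph.is3Clique_triple_iff.2 ⟨hab, hac, hbc⟩)

end Graphs

section

variable {B : Type v} {W : Type u} [Group W] {M : CoxeterMatrix B}

/-! ### Visual splittings, refinements and collapses -/

namespace VisualGraph

open GraphOfSubgroups

/-- The visual graph with one edge. -/
def visualAmalgam (X Y D : Set B) : VisualGraph B where
  ι := Bool
  graph := ⊤
  vert b := bif b then Y else X
  edge _ _ := D

theorem toGraph_visualAmalgam (cs : CoxeterSystem M W) (X Y D : Set B) :
    (visualAmalgam X Y D).toGraph cs =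
      amalgam (visualSubgroup cs X) (visualSubgroup cs Y) (visualSubgroup cs D) := by
  unfold toGraph visualAmalgam amalgam
  congr 1
  funext b
  cases b <;> rfl

theorem isTreeDecomposition_visualAmalgam {X Y : Set B}
    (h : ∀ s ∈ X, s ∉ Y → ∀ t ∈ Y, t ∉ X → M s t = 0) :
    (visualAmalgam X Y (X ∩ Y)).IsTreeDecomposition M (X ∪ Y) where
  finite := inferInstanceAs (Finite Bool)
  isTree := ⟨SimpleGraph.connected_top (V := Bool),
    SimpleGraph.IsAcyclic.of_card_le_two (V := Bool) (by simp)⟩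
  edge_symm _ _ _ := rfl
  edge_subset x _ _ := by
    cases x
    · exact Set.inter_subset_left
    · exact Set.inter_subset_right
  vert_subset x := by
    cases x
    · exact Set.subset_union_left
    · exact Set.subset_union_right
  exists_mem_mem s hs t ht hst := by
    have h3 := M.symmetric s t
    by_cases hX : s ∈ X ∧ t ∈ X
    · exact ⟨false, hX⟩
    · refine ⟨true, ?_⟩
      change s ∈ Y ∧ t ∈ Y
      simp only [Set.mem_union] at hs ht
      by_contra hY
      have h1 := h s
      have h2 := h t
      rw [M.symmetric] at hst
      by_cases hsX : s ∈ X
      · have htX : t ∉ X := fun h' => hX ⟨hsX, h'⟩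
        have htY : t ∈ Y := ht.resolve_left htX
        have hsY : s ∉ Y := fun h' => hY ⟨h', htY⟩
        exact hst (h3 ▸ h1 hsX hsY t htY htX)
      · have hsY : s ∈ Y := hs.resolve_left hsX
        have htY : t ∉ Y := fun h' => hY ⟨hsY, h'⟩
        exact hst (h2 (ht.resolve_right htY) htY s hsY hsX)
  connected s x y hx hy := by
    by_cases hxy : x = y
    · rw [hxy]
    · refine .single ⟨hxy, ?_⟩
      cases x <;> cases y
      · exact absurd rfl hxy
      · exact ⟨hx, hy⟩
      · exact ⟨hy, hx⟩
      · exact absurd rfl hxy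

/-- A visual splitting of a visual subgroup. -/
theorem isDecompositionOf_amalgam (cs : CoxeterSystem M W) {X Y : Set B}
    (h : ∀ s ∈ X, s ∉ Y → ∀ t ∈ Y, t ∉ X → M s t = 0) :
    (amalgam (visualSubgroup cs X) (visualSubgroup cs Y)
      (visualSubgroup cs (X ∩ Y))).IsDecompositionOf (visualSubgroup cs (X ∪ Y)) := by
  rw [← toGraph_visualAmalgam]
  exact (isTreeDecomposition_visualAmalgam h).isDecompositionOf cs

/-- Replace the vertex `u` by an edge `D` with end points `X` and `Y`. -/
def visualRefine (Φ : VisualGraph B) (u : Φ.ι) (X Y D : Set B) (side : Φ.ι → Bool) :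
    VisualGraph B where
  ι := Option Φ.ι
  graph := refineGraph Φ.graph u side
  vert
    | none => Y
    | some x => if x = u then X else Φ.vert x
  edge p q :=
    if refineProj u p = u ∧ refineProj u q = u then D
    else Φ.edge (refineProj u p) (refineProj u q)

theorem toGraph_visualRefine (Φ : VisualGraph B) (cs : CoxeterSystem M W) (u : Φ.ι)
    (X Y D : Set B) (side : Φ.ι → Bool) :
    (Φ.visualRefine u X Y D side).toGraph cs =
      (Φ.toGraph cs).refine u (visualSubgroup cs X) (visualSubgroup cs Y) (visualSubgroup cs D)
        side (fun _ => 1) := by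
  unfold toGraph visualRefine GraphOfSubgroups.refine
  congr 1
  · funext p
    cases p with
    | none => rfl
    | some x =>
      change visualSubgroup cs (if x = u then X else Φ.vert x) =
        if x = u then visualSubgroup cs X else conjSubgroup 1 (visualSubgroup cs (Φ.vert x))
      rw [conjSubgroup_one]
      split_ifs <;> rfl
  · funext p q
    simp only [conjSubgroup_one]
    by_cases hp : refineProj u p = u <;> by_cases hq : refineProj u q = u <;> simp [hp, hq]

theorem visualRefine_edge_eq_or {Φ : VisualGraph B} {u : Φ.ι} {X Y D : Set B} {side : Φ.ι → Bool}
    {p q : (Φ.visualRefine u X Y D side).ι} (hpq : (Φ.visualRefine u X Y D side).graph.Adj p q) :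
    (Φ.visualRefine u X Y D side).edge p q = D ∨
      ∃ x y, Φ.graph.Adj x y ∧ (Φ.visualRefine u X Y D side).edge p q = Φ.edge x y := by
  rcases (refineGraph_adj (G := Φ.graph) u side p q).1 hpq with
    ⟨rfl, rfl⟩ | ⟨rfl, rfl⟩ | ⟨hadj, -, -⟩
  · exact Or.inl (if_pos ⟨rfl, rfl⟩)
  · exact Or.inl (if_pos ⟨rfl, rfl⟩)
  · exact Or.inr ⟨_, _, hadj, if_neg fun h => hadj.ne (h.1.trans h.2.symm)⟩

theorem isTreeDecomposition_visualRefine {Φ : VisualGraph B} {V : Set B}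
    (h : Φ.IsTreeDecomposition M V) {u : Φ.ι} {X Y : Set B} (hu : Φ.vert u = X ∪ Y)
    (hXY : ∀ s ∈ X, s ∉ Y → ∀ t ∈ Y, t ∉ X → M s t = 0) {side : Φ.ι → Bool}
    (hside : ∀ y, Φ.graph.Adj u y → Φ.edge u y ⊆ if side y then Y else X) :
    (Φ.visualRefine u X Y (X ∩ Y) side).IsTreeDecomposition M V := by
  have hnone : (Φ.visualRefine u X Y (X ∩ Y) side).vert none = Y := rfl
  have hsome : ∀ x, (Φ.visualRefine u X Y (X ∩ Y) side).vert (some x) =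
      if x = u then X else Φ.vert x := fun _ => rfl
  have hproj : ∀ p, (Φ.visualRefine u X Y (X ∩ Y) side).vert p ⊆ Φ.vert (refineProj u p) := by
    rintro (_ | x)
    · rw [hnone]
      exact Set.subset_union_right.trans hu.ge
    · rw [hsome]
      split_ifs with hx
      · rw [hx]
        exact Set.subset_union_left.trans hu.ge
      · exact subset_rfl
  have hattach : ∀ x y, Φ.graph.Adj x y →
      Φ.edge x y ⊆ (Φ.visualRefine u X Y (X ∩ Y) side).vert (refineAttach u side x y) := by
    intro x y hxy
    unfold refineAttach
    split_ifs with hx hs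
    · subst hx
      rw [hnone]
      simpa [hs] using hside y hxy
    · subst hx
      rw [hsome, if_pos rfl]
      simpa [hs] using hside y hxy
    · rw [hsome, if_neg hx]
      exact h.edge_subset x y hxy
  have hadj : ∀ p q, (Φ.visualRefine u X Y (X ∩ Y) side).graph.Adj p q ↔ _ :=
    fun p q => refineGraph_adj (G := Φ.graph) u side p q
  have hedge : ∀ p q, Φ.graph.Adj (refineProj u p) (refineProj u q) →
      (Φ.visualRefine u X Y (X ∩ Y) side).edge p q = Φ.edge (refineProj u p) (refineProj u q) :=
    fun p q hpq => if_neg fun h' => hpq.ne (h'.1.trans h'.2.symm)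
  have hedge₁ : (Φ.visualRefine u X Y (X ∩ Y) side).edge (some u) none = X ∩ Y :=
    if_pos ⟨rfl, rfl⟩
  have hedge₂ : (Φ.visualRefine u X Y (X ∩ Y) side).edge none (some u) = X ∩ Y :=
    if_pos ⟨rfl, rfl⟩
  have hfin := h.finite
  refine ⟨inferInstanceAs (Finite (Option Φ.ι)), refineGraph_isTree h.isTree u side, ?_, ?_,
    fun p => (hproj p).trans (h.vert_subset _), ?_, ?_⟩
  · intro p q hpq
    rcases (hadj p q).1 hpq with ⟨rfl, rfl⟩ | ⟨rfl, rfl⟩ | ⟨hpq, -, -⟩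
    · rw [hedge₁, hedge₂]
    · rw [hedge₁, hedge₂]
    · rw [hedge p q hpq, hedge q p hpq.symm, h.edge_symm _ _ hpq]
  · intro p q hpq
    rcases (hadj p q).1 hpq with ⟨rfl, rfl⟩ | ⟨rfl, rfl⟩ | ⟨hpq, hp, -⟩
    · rw [hedge₁, hsome, if_pos rfl]
      exact Set.inter_subset_left
    · rw [hedge₂, hnone]
      exact Set.inter_subset_right
    · rw [hedge p q hpq]
      have := hattach _ _ hpq
      rwa [← hp] at this
  · intro s hs t ht hst
    obtain ⟨x, hsx, htx⟩ := h.exists_mem_mem s hs t ht hst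
    by_cases hx : x = u
    · subst hx
      rw [hu] at hsx htx
      obtain ⟨b, hb⟩ := (isTreeDecomposition_visualAmalgam hXY).exists_mem_mem s hsx t htx hst
      cases b
      · exact ⟨some x, by rw [hsome, if_pos rfl]; exact hb⟩
      · exact ⟨none, hb⟩
    · exact ⟨some x, by rw [hsome, if_neg hx]; exact ⟨hsx, htx⟩⟩
  · intro s p q hp hq
    have hfib : ∀ p q, refineProj u p = refineProj u q →
        s ∈ (Φ.visualRefine u X Y (X ∩ Y) side).vert p →
        s ∈ (Φ.visualRefine u X Y (X ∩ Y) side).vert q →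
        Relation.ReflTransGen (fun x y => (Φ.visualRefine u X Y (X ∩ Y) side).graph.Adj x y ∧
          s ∈ (Φ.visualRefine u X Y (X ∩ Y) side).edge x y) p q := by
      intro p q hpq hp hq
      rcases eq_or_of_refineProj_eq hpq with rfl | ⟨rfl, rfl⟩ | ⟨rfl, rfl⟩
      · exact .refl
      · refine .single ⟨(hadj _ _).2 (Or.inl ⟨rfl, rfl⟩), ?_⟩
        rw [hsome, if_pos rfl] at hp
        rw [hedge₁]
        exact ⟨hp, hq⟩
      · refine .single ⟨(hadj _ _).2 (Or.inr (Or.inl ⟨rfl, rfl⟩)), ?_⟩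
        rw [hsome, if_pos rfl] at hq
        rw [hedge₂]
        exact ⟨hq, hp⟩
    have key := h.connected s _ _ (hproj p hp) (hproj q hq)
    generalize hy : refineProj u q = y at key
    induction key generalizing q with
    | refl => exact hfib p q hy.symm hp hq
    | @tail z y _ hzy ih =>
      have hz := hattach z y hzy.1 hzy.2
      have hy' := hattach y z hzy.1.symm (h.edge_symm _ _ hzy.1 ▸ hzy.2)
      refine ((ih _ hz (refineProj_refineAttach u side z y)).tail
        ⟨refineGraph_adj_attach u side hzy.1, ?_⟩).trans
          (hfib _ q (by rw [refineProj_refineAttach, hy]) hy' hq)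
      rw [hedge _ _ (by simpa using hzy.1)]
      simpa using hzy.2

/-- Collapse the edge `ab`, absorbing the vertex `a` into the vertex `b`. -/
def visualCollapse (Φ : VisualGraph B) (a b : Φ.ι) : VisualGraph B where
  ι := {x : Φ.ι // x ≠ a}
  graph := collapseGraph Φ.graph a b
  vert x := Φ.vert x.1
  edge x y :=
    if Φ.graph.Adj x.1 y.1 then Φ.edge x.1 y.1
    else if x.1 = b then Φ.edge a y.1
    else Φ.edge x.1 a

theorem toGraph_visualCollapse (Φ : VisualGraph B) (cs : CoxeterSystem M W) (a b : Φ.ι) :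
    (Φ.visualCollapse a b).toGraph cs = (Φ.toGraph cs).collapse a b := by
  have h : (fun x y : {x : Φ.ι // x ≠ a} => visualSubgroup cs
      (if Φ.graph.Adj x.1 y.1 then Φ.edge x.1 y.1
        else if x.1 = b then Φ.edge a y.1 else Φ.edge x.1 a)) =
      fun x y => if Φ.graph.Adj x.1 y.1 then visualSubgroup cs (Φ.edge x.1 y.1)
        else if x.1 = b then visualSubgroup cs (Φ.edge a y.1)
        else visualSubgroup cs (Φ.edge x.1 a) := by
    funext x y
    rw [apply_ite (visualSubgroup cs), apply_ite (visualSubgroup cs)]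
  exact congrArg (fun e => (⟨{x : Φ.ι // x ≠ a}, collapseGraph Φ.graph a b,
    fun x => visualSubgroup cs (Φ.vert x.1), e⟩ : GraphOfSubgroups W)) h

theorem IsTreeDecomposition.visualCollapse_edge {Φ : VisualGraph B} {V : Set B}
    (h : Φ.IsTreeDecomposition M V) {a b : Φ.ι} (hab : Φ.graph.Adj a b) {x y : Φ.ι}
    (hxy : Φ.graph.Adj x y)
    (hne : collapseProj a b hab.ne x ≠ collapseProj a b hab.ne y) :
    (Φ.visualCollapse a b).edge (collapseProj a b hab.ne x) (collapseProj a b hab.ne y) =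
      Φ.edge x y := by
  by_cases hx : x = a
  · subst hx
    have hy : y ≠ x := hxy.ne'
    rw [collapseProj_self, collapseProj_of_ne hab.ne hy]
    change (if _ then _ else _) = _
    rw [if_neg (not_adj_of_isTree h.isTree hab hxy), if_pos rfl]
  · rw [collapseProj_of_ne hab.ne hx] at hne ⊢
    by_cases hy : y = a
    · subst hy
      rw [collapseProj_self] at hne ⊢
      change (if _ then _ else _) = _
      rw [if_neg fun h' => not_adj_of_isTree h.isTree hab hxy.symm h'.symm,
        if_neg fun h' => hne (Subtype.ext h')]
    · rw [collapseProj_of_ne hab.ne hy]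
      exact if_pos hxy

theorem exists_adj_of_collapseGraph_adj {ι : Type} {G : SimpleGraph ι} {a b : ι} (hab : G.Adj a b)
    {x y : {x : ι // x ≠ a}} (hxy : (collapseGraph G a b).Adj x y) :
    ∃ x' y', G.Adj x' y' ∧ collapseProj a b hab.ne x' = x ∧ collapseProj a b hab.ne y' = y := by
  rcases (collapseGraph_adj a b x y).1 hxy with h | ⟨-, ⟨hx, h⟩ | ⟨hy, h⟩⟩
  · exact ⟨x, y, h, by simp, by simp⟩
  · exact ⟨a, y, h, by simp [← hx], by simp⟩
  · exact ⟨x, a, h.symm, by simp, by simp [← hy]⟩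

theorem IsTreeDecomposition.exists_edge_eq_of_visualCollapse {Φ : VisualGraph B} {V : Set B}
    (h : Φ.IsTreeDecomposition M V) {a b : Φ.ι} (hab : Φ.graph.Adj a b)
    {x y : (Φ.visualCollapse a b).ι} (hxy : (Φ.visualCollapse a b).graph.Adj x y) :
    ∃ x' y', Φ.graph.Adj x' y' ∧ collapseProj a b hab.ne x' = x ∧
      collapseProj a b hab.ne y' = y ∧ (Φ.visualCollapse a b).edge x y = Φ.edge x' y' := by
  obtain ⟨x', y', h', rfl, rfl⟩ := exists_adj_of_collapseGraph_adj hab hxy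
  exact ⟨x', y', h', rfl, rfl, h.visualCollapse_edge hab h' hxy.ne⟩

theorem vert_subset_visualCollapse {Φ : VisualGraph B} {a b : Φ.ι} (hab : Φ.graph.Adj a b)
    (hsub : Φ.vert a ⊆ Φ.vert b) (x : Φ.ι) :
    Φ.vert x ⊆ (Φ.visualCollapse a b).vert (collapseProj a b hab.ne x) := by
  by_cases hx : x = a
  · subst hx
    rw [collapseProj_self]
    exact hsub
  · rw [collapseProj_of_ne hab.ne hx]
    exact subset_rfl

theorem IsTreeDecomposition.visualCollapse {Φ : VisualGraph B} {V : Set B}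
    (h : Φ.IsTreeDecomposition M V) {a b : Φ.ι} (hab : Φ.graph.Adj a b)
    (hsub : Φ.vert a ⊆ Φ.vert b) : (Φ.visualCollapse a b).IsTreeDecomposition M V := by
  have hfin := h.finite
  have hle := vert_subset_visualCollapse hab hsub
  refine ⟨inferInstanceAs (Finite {x : Φ.ι // x ≠ a}), collapseGraph_isTree h.isTree hab, ?_, ?_,
    fun x => h.vert_subset x.1, ?_, ?_⟩
  · intro x y hxy
    obtain ⟨x', y', h', rfl, rfl, e⟩ := h.exists_edge_eq_of_visualCollapse hab hxy
    rw [e, h.visualCollapse_edge hab h'.symm hxy.ne', h.edge_symm _ _ h']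
  · intro x y hxy
    obtain ⟨x', y', h', rfl, rfl, e⟩ := h.exists_edge_eq_of_visualCollapse hab hxy
    rw [e]
    exact (h.edge_subset _ _ h').trans (hle x')
  · intro s hs t ht hst
    obtain ⟨x, hsx, htx⟩ := h.exists_mem_mem s hs t ht hst
    exact ⟨collapseProj a b hab.ne x, hle x hsx, hle x htx⟩
  · intro s x y hx hy
    have key := h.connected s x.1 y.1 hx hy
    have : ∀ y', Relation.ReflTransGen (fun x y => Φ.graph.Adj x y ∧ s ∈ Φ.edge x y) x.1 y' →
        Relation.ReflTransGen (fun x y => (Φ.visualCollapse a b).graph.Adj x y ∧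
          s ∈ (Φ.visualCollapse a b).edge x y) x (collapseProj a b hab.ne y') := by
      intro y' key
      induction key with
      | refl => exact (congrArg _ (collapseProj_coe hab.ne x)).mpr .refl
      | @tail z y _ hzy ih =>
        by_cases hne : collapseProj a b hab.ne z = collapseProj a b hab.ne y
        · rwa [← hne]
        · refine ih.tail ⟨(collapseGraph_adj_proj hab.ne hzy.1).resolve_left hne, ?_⟩
          rw [h.visualCollapse_edge hab hzy.1 hne]
          exact hzy.2
    exact (congrArg _ (collapseProj_coe hab.ne y)).mp (this y.1 key)

/-- A tree decomposition can be reduced; the result has fewer edges and the vertices are not made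
smaller. -/
theorem IsTreeDecomposition.exists_reducesTo {Φ : VisualGraph B} {V : Set B}
    (h : Φ.IsTreeDecomposition M V) (cs : CoxeterSystem M W) :
    ∃ Φ' : VisualGraph B, Φ'.IsTreeDecomposition M V ∧
      (Φ.toGraph cs).ReducesTo (Φ'.toGraph cs) ∧
      (∀ x y, Φ'.graph.Adj x y → ∃ x' y', Φ.graph.Adj x' y' ∧ Φ'.edge x y = Φ.edge x' y') ∧
      ∀ x, ∃ x', Φ.vert x ⊆ Φ'.vert x' := by
  induction hn : Nat.card Φ.ι using Nat.strong_induction_on generalizing Φ with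
  | _ n ih =>
    by_cases hred : (Φ.toGraph cs).IsReduced
    · exact ⟨Φ, h, ⟨.refl, hred⟩, fun x y hxy => ⟨x, y, hxy, rfl⟩, fun x => ⟨x, subset_rfl⟩⟩
    obtain ⟨a, b, hab, he⟩ : ∃ a b, Φ.graph.Adj a b ∧ Φ.edge a b = Φ.vert a := by
      unfold GraphOfSubgroups.IsReduced at hred
      push Not at hred
      obtain ⟨x, y, hxy, hne⟩ := hred
      have hxy : Φ.graph.Adj x y := hxy
      by_cases he : Φ.edge x y = Φ.vert x
      · exact ⟨x, y, hxy, he⟩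
      · refine ⟨y, x, hxy.symm, ?_⟩
        have := visualSubgroup_injective cs
          (hne fun h' => he (visualSubgroup_injective cs h'))
        rw [← this, h.edge_symm _ _ hxy]
    have hsub : Φ.vert a ⊆ Φ.vert b := by
      rw [← he, h.edge_symm _ _ hab]
      exact h.edge_subset _ _ hab.symm
    have hfin := h.finite
    have hcard : Nat.card (Φ.visualCollapse a b).ι < n := by
      rw [← hn]
      exact Finite.card_subtype_lt (p := fun x : Φ.ι => x ≠ a) (x := a) (by simp)
    obtain ⟨Φ', h1, h2, h3, h4⟩ := ih _ hcard (h.visualCollapse hab hsub) rfl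
    refine ⟨Φ', h1, ⟨.head ⟨a, b, hab, congrArg (visualSubgroup cs) he,
      toGraph_visualCollapse Φ cs a b⟩ h2.1, h2.2⟩, ?_, ?_⟩
    · intro x y hxy
      obtain ⟨x', y', h', e⟩ := h3 x y hxy
      obtain ⟨x'', y'', h'', -, -, e'⟩ := h.exists_edge_eq_of_visualCollapse hab h'
      exact ⟨x'', y'', h'', e.trans e'⟩
    · intro x
      obtain ⟨x', hx'⟩ := h4 (collapseProj a b hab.ne x)
      exact ⟨x', (vert_subset_visualCollapse hab hsub x).trans hx'⟩

end VisualGraph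

end

section

variable {B : Type v} {W : Type u} [Group W] {M : CoxeterMatrix B}

/-! ### Minimal splitting subgroups -/

theorem VirtuallyAbelian.mono {A A' : Subgroup W} (hA : VirtuallyAbelian A) (h : A' ≤ A) :
    VirtuallyAbelian A' := by
  obtain ⟨N, -, hN, hcomm⟩ := hA
  refine ⟨N ⊓ A', inf_le_right, ?_, fun x hx y hy => hcomm x hx.1 y hy.1⟩
  rw [Subgroup.inf_relIndex_right]
  exact fun h0 => hN (Subgroup.relIndex_eq_zero_of_le_right h h0)

theorem GraphOfSubgroups.mem_minimalSplitting_of_le {Λ : GraphOfSubgroups W} {x : Λ.ι}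
    {A A' : Subgroup W} (hA : A ∈ Λ.minimalSplitting x) (hle : A' ≤ A)
    (hA' : Λ.SplitsCompatiblyOver x A') : A' ∈ Λ.minimalSplitting x := by
  refine ⟨hA.1.mono hle, hA', ?_⟩
  rintro ⟨C, hC, hCs, h0, hne⟩
  refine hA.2.2 ⟨C, hC, hCs, ?_, ?_⟩
  · rw [Subgroup.inf_relIndex_right] at h0 ⊢
    exact Subgroup.relIndex_eq_zero_of_le_right hle h0
  · exact fun h => hne (Subgroup.relIndex_eq_zero_of_le_left (inf_le_inf_left C hle) h)

namespace VisualGraph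

open GraphOfSubgroups

/-- A visual splitting of a vertex group that is compatible with the decomposition. -/
theorem isCompatibleSplitting_visual (cs : CoxeterSystem M W) (Φ : VisualGraph B) (u : Φ.ι)
    {X Y : Set B} (hu : X ∪ Y = Φ.vert u)
    (hXY : ∀ s ∈ X, s ∉ Y → ∀ t ∈ Y, t ∉ X → M s t = 0) (hX : ¬ X ⊆ Y) (hY : ¬ Y ⊆ X)
    (hedge : ∀ y, Φ.graph.Adj u y → Φ.edge u y ⊆ X ∨ Φ.edge u y ⊆ Y) :
    (Φ.toGraph cs).IsCompatibleSplitting u (visualSubgroup cs X) (visualSubgroup cs Y)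
      (visualSubgroup cs (X ∩ Y)) := by
  refine ⟨?_, fun h => hX ?_, fun h => hY ?_, fun y hy => ?_⟩
  · have := isDecompositionOf_amalgam cs hXY
    rwa [hu] at this
  · exact Set.inter_eq_left.1 (visualSubgroup_injective cs h)
  · exact Set.inter_eq_right.1 (visualSubgroup_injective cs h)
  · rcases hedge y hy with h | h
    · exact ⟨false, 1, one_mem _, by rw [conjSubgroup_one]; exact visualSubgroup_mono cs h⟩
    · exact ⟨true, 1, one_mem _, by rw [conjSubgroup_one]; exact visualSubgroup_mono cs h⟩

section JSJ

variable {cs : CoxeterSystem M W} {Ψ Ψ₁ Ψ₂ : VisualGraph B} {x : Ψ.ι}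

theorem edge_subset_sideSet_of_compatible
    (hV : ∀ y, Ψ.graph.Adj x y → Ψ.edge x y ⊆ Ψ.vert x)
    (h : (Ψ.toGraph cs).IsWeaklyJSJ x (Ψ₁.toGraph cs)) {a b : Ψ₁.ι} (hab : Ψ₁.graph.Adj a b)
    {y : Ψ.ι} (hy : Ψ.graph.Adj x y) :
    Ψ.edge x y ⊆ Ψ₁.sideSet a b ∨ Ψ.edge x y ⊆ Ψ₁.sideSet b a := by
  obtain ⟨z, k, hk, hle⟩ := h.compatible y hy
  exact subset_sideSet_of_le_conjSubgroup h.decomposition hab (hV y hy) hk hle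

theorem edge_subset_of_isWeaklyJSJ (h : (Ψ.toGraph cs).IsWeaklyJSJ x (Ψ₁.toGraph cs))
    {c d : Ψ₁.ι} (hcd : Ψ₁.graph.Adj c d) : Ψ₁.edge c d ⊆ Ψ.vert x :=
  (edge_subset_of_decomposition h.decomposition hcd).trans
    (vert_subset_of_decomposition h.decomposition c)

theorem edge_subset_sideSet_of_isWeaklyJSJ (h₁ : (Ψ.toGraph cs).IsWeaklyJSJ x (Ψ₁.toGraph cs))
    (h₂ : (Ψ.toGraph cs).IsWeaklyJSJ x (Ψ₂.toGraph cs)) {a b : Ψ₂.ι} (hab : Ψ₂.graph.Adj a b)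
    {c d : Ψ₁.ι} (hcd : Ψ₁.graph.Adj c d) :
    Ψ₁.edge c d ⊆ Ψ₂.sideSet a b ∨ Ψ₁.edge c d ⊆ Ψ₂.sideSet b a := by
  obtain ⟨z, k, hk, hle⟩ := h₂.elliptic _ (h₁.edge_mem c d hcd)
  exact subset_sideSet_of_le_conjSubgroup h₂.decomposition hab (edge_subset_of_isWeaklyJSJ h₁ hcd)
    hk hle

/-- If an edge `ab` of `Ψ₂` separates the vertex `u` of `Ψ₁` and lies beyond the edge `uc` of `Ψ₁`,
then the corner of the two edges gives a splitting over their intersection. -/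
theorem splitsCompatiblyOver_corner (hV : ∀ y, Ψ.graph.Adj x y → Ψ.edge x y ⊆ Ψ.vert x)
    (h₁ : (Ψ.toGraph cs).IsWeaklyJSJ x (Ψ₁.toGraph cs))
    (h₂ : (Ψ.toGraph cs).IsWeaklyJSJ x (Ψ₂.toGraph cs)) {u c : Ψ₁.ι} (huc : Ψ₁.graph.Adj u c)
    {a b : Ψ₂.ι} (hab : Ψ₂.graph.Adj a b) (hE : Ψ₂.edge a b ⊆ Ψ₁.sideSet c u)
    (hF : Ψ₁.edge u c ⊆ Ψ₂.sideSet a b) (hna : ¬ Ψ₁.vert u ⊆ Ψ₂.sideSet a b)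
    (hnb : ¬ Ψ₁.vert u ⊆ Ψ₂.sideSet b a) :
    (Ψ.toGraph cs).SplitsCompatiblyOver x (visualSubgroup cs (Ψ₁.vert u ∩ Ψ₂.edge a b)) := by
  have hu₁ := sideSet_union_of_decomposition h₁.decomposition u c
  have hi₁ := sideSet_inter_of_decomposition h₁.decomposition huc
  have hu₂ := sideSet_union_of_decomposition h₂.decomposition a b
  have hi₂ := sideSet_inter_of_decomposition h₂.decomposition hab
  have hQ : Ψ₁.vert u ⊆ Ψ₁.sideSet u c := Ψ₁.vert_subset_sideSet (left_mem_edgeSide _ _ _)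
  have hQV : Ψ₁.vert u ⊆ Ψ.vert x := vert_subset_of_decomposition h₁.decomposition u
  have hFQ : Ψ₁.edge u c ⊆ Ψ₁.vert u := edge_subset_of_decomposition h₁.decomposition huc
  have z₁ := fun s t => eq_zero_of_mem_sideSet h₁.decomposition huc (s := s) (t := t)
  have z₂ := fun s t => eq_zero_of_mem_sideSet h₂.decomposition hab (s := s) (t := t)
  have hR₁ := fun y => edge_subset_sideSet_of_compatible hV h₁ huc (y := y)
  have hR₂ := fun y => edge_subset_sideSet_of_compatible hV h₂ hab (y := y)
  rw [← hi₁] at hFQ hF z₁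
  rw [← hi₂] at hE z₂ ⊢
  generalize Ψ₁.sideSet u c = XF at *
  generalize Ψ₁.sideSet c u = YF at *
  generalize Ψ₂.sideSet a b = X at *
  generalize Ψ₂.sideSet b a = Y at *
  have hinter : (Y ∩ XF) ∩ (X ∪ YF) = Ψ₁.vert u ∩ (X ∩ Y) := by
    ext s
    have e1 := @hE s
    have e2 := @hF s
    have e3 := @hFQ s
    have e4 := @hQ s
    simp only [Set.mem_inter_iff, Set.mem_union] at *
    tauto
  have hunion : (Y ∩ XF) ∪ (X ∪ YF) = Ψ.vert x := by
    rw [← Set.union_self (Ψ.vert x)]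
    nth_rw 1 [← hu₁]
    rw [← hu₂]
    ext s
    have e1 : s ∈ XF ∪ YF ↔ s ∈ X ∪ Y := by rw [hu₁, hu₂]
    simp only [Set.mem_inter_iff, Set.mem_union] at *
    tauto
  rw [← hinter]
  refine ⟨_, _, isCompatibleSplitting_visual cs Ψ x hunion ?_ ?_ ?_ ?_⟩
  · rintro s ⟨hsY, hsXF⟩ hs t ht htn
    have htV : t ∈ Ψ.vert x := hunion ▸ Or.inr ht
    simp only [Set.mem_inter_iff, Set.mem_union, not_or, not_and] at hs ht htn
    by_cases htY : t ∈ Y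
    · have htX := htn htY
      have : t ∈ YF := (hu₁.ge htV).resolve_left htX
      exact z₁ s t hsXF (fun h => hs.2 h.2) this fun h => htX h.1
    · have : t ∈ X := (hu₂.ge htV).resolve_right htY
      rw [M.symmetric]
      exact z₂ t s this (fun h => htY h.2) hsY fun h => hs.1 h.1
  · obtain ⟨q, hq, hqX⟩ := Set.not_subset.1 hna
    have hqY : q ∈ Y := (hu₂.ge (hQV hq)).resolve_left hqX
    intro hsub
    rcases hsub ⟨hqY, hQ hq⟩ with h | h
    · exact hqX h
    · exact hqX (hF ⟨hQ hq, h⟩)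
  · obtain ⟨q, hq, hqY⟩ := Set.not_subset.1 hnb
    have hqX : q ∈ X := (hu₂.ge (hQV hq)).resolve_right hqY
    exact fun hsub => hqY (hsub (Or.inl hqX)).1
  · intro y hy
    rcases hR₂ y hy with h | h
    · exact Or.inr (h.trans Set.subset_union_left)
    · rcases hR₁ y hy with h' | h'
      · exact Or.inl (Set.subset_inter h h')
      · exact Or.inr (h'.trans Set.subset_union_right)

theorem inter_mem_minimalSplitting [Finite B]
    (hV : ∀ y, Ψ.graph.Adj x y → Ψ.edge x y ⊆ Ψ.vert x)
    (h₁ : (Ψ.toGraph cs).IsWeaklyJSJ x (Ψ₁.toGraph cs))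
    (h₂ : (Ψ.toGraph cs).IsWeaklyJSJ x (Ψ₂.toGraph cs)) {u : Ψ₁.ι} {a b : Ψ₂.ι}
    (hab : Ψ₂.graph.Adj a b) (hna : ¬ Ψ₁.vert u ⊆ Ψ₂.sideSet a b)
    (hnb : ¬ Ψ₁.vert u ⊆ Ψ₂.sideSet b a) :
    visualSubgroup cs (Ψ₁.vert u ∩ Ψ₂.edge a b) ∈ (Ψ.toGraph cs).minimalSplitting x := by
  have hEM : visualSubgroup cs (Ψ₂.edge a b) ∈ (Ψ.toGraph cs).minimalSplitting x :=
    h₂.edge_mem a b hab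
  have hEV := edge_subset_of_isWeaklyJSJ h₂ hab
  obtain ⟨z, k, hk, hle⟩ := h₁.elliptic _ hEM
  obtain ⟨v, hv⟩ := exists_subset_vert_of_le_conjSubgroup h₁.decomposition hEV hk hle
  by_cases huv : u = v
  · subst huv
    rwa [Set.inter_eq_right.2 hv]
  obtain ⟨c, huc, hvc, -⟩ := exists_adj_mem_edgeSide (isTree_of_decomposition h₁.decomposition) huv
  have hE : Ψ₂.edge a b ⊆ Ψ₁.sideSet c u := hv.trans (Ψ₁.vert_subset_sideSet hvc)
  refine mem_minimalSplitting_of_le hEM (visualSubgroup_mono cs Set.inter_subset_right) ?_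
  rcases edge_subset_sideSet_of_isWeaklyJSJ h₁ h₂ hab huc with hF | hF
  · exact splitsCompatiblyOver_corner hV h₁ h₂ huc hab hE hF hna hnb
  · rw [edge_symm_of_decomposition h₂.decomposition hab] at hE ⊢
    exact splitsCompatiblyOver_corner hV h₁ h₂ huc hab.symm hE hF hnb hna

/-- Every vertex of a visual JSJ decomposition lies in a vertex of any weakly JSJ one. -/
theorem exists_vert_subset_vert [Finite B]
    (hV : ∀ y, Ψ.graph.Adj x y → Ψ.edge x y ⊆ Ψ.vert x)
    (h₁ : (Ψ.toGraph cs).IsJSJ x (Ψ₁.toGraph cs))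
    (h₂ : (Ψ.toGraph cs).IsWeaklyJSJ x (Ψ₂.toGraph cs)) (u : Ψ₁.ι) :
    ∃ z, Ψ₁.vert u ⊆ Ψ₂.vert z := by
  have d₁ := h₁.weakly.decomposition
  have d₂ := h₂.decomposition
  have hQV : Ψ₁.vert u ⊆ Ψ.vert x := vert_subset_of_decomposition d₁ u
  refine exists_subset_vert_of_forall d₂ hQV fun a b hab => ?_
  by_contra! hcon
  obtain ⟨hna, hnb⟩ := hcon
  have hD := inter_mem_minimalSplitting hV h₁.weakly h₂ hab hna hnb
  have hu₂ := sideSet_union_of_decomposition d₂ a b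
  have hi₂ := sideSet_inter_of_decomposition d₂ hab
  obtain ⟨X, hX⟩ : ∃ X, X = Ψ₁.vert u ∩ Ψ₂.sideSet a b := ⟨_, rfl⟩
  obtain ⟨Y, hY⟩ : ∃ Y, Y = Ψ₁.vert u ∩ Ψ₂.sideSet b a := ⟨_, rfl⟩
  have hinter : X ∩ Y = Ψ₁.vert u ∩ Ψ₂.edge a b := by
    rw [hX, hY, ← hi₂, ← Set.inter_inter_distrib_left]
  have hunion : X ∪ Y = Ψ₁.vert u := by
    rw [hX, hY, ← Set.inter_union_distrib_left, hu₂]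
    exact Set.inter_eq_left.2 hQV
  rw [← hinter] at hD
  have hXY : ∀ s ∈ X, s ∉ Y → ∀ t ∈ Y, t ∉ X → M s t = 0 := by
    intro s hs hsY t ht htX
    rw [hX] at hs htX
    rw [hY] at ht hsY
    refine eq_zero_of_mem_sideSet d₂ hab hs.2 (fun h => ?_) ht.2 fun h => ?_
    · exact hsY ⟨hs.1, (hi₂.ge h).2⟩
    · exact htX ⟨ht.1, (hi₂.ge h).1⟩
  have hnX : ¬ X ⊆ Y := fun h => hnb fun q hq => by
    have : q ∈ Y := (Set.union_subset h subset_rfl) (hunion.ge hq)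
    rw [hY] at this
    exact this.2
  have hnY : ¬ Y ⊆ X := fun h => hna fun q hq => by
    have : q ∈ X := (Set.union_subset subset_rfl h) (hunion.ge hq)
    rw [hX] at this
    exact this.2
  have hsub : ∀ R ⊆ Ψ₁.vert u, R ⊆ Ψ₂.sideSet a b ∨ R ⊆ Ψ₂.sideSet b a → R ⊆ X ∨ R ⊆ Y := by
    intro R hR
    rw [hX, hY]
    exact Or.imp (Set.subset_inter hR) (Set.subset_inter hR)
  have hedge : ∀ y, Ψ₁.graph.Adj u y → Ψ₁.edge u y ⊆ X ∨ Ψ₁.edge u y ⊆ Y := fun y hy =>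
    hsub _ (edge_subset_of_decomposition d₁ hy)
      (edge_subset_sideSet_of_isWeaklyJSJ h₁.weakly h₂ hab hy)
  have hsplit := isCompatibleSplitting_visual cs Ψ₁ u hunion hXY hnX hnY hedge
  let side : Ψ₁.ι → Bool := fun y => decide (¬ Ψ₁.edge u y ⊆ X)
  have hside : ∀ y, Ψ₁.graph.Adj u y → Ψ₁.edge u y ⊆ if side y then Y else X := by
    intro y hy
    by_cases h : Ψ₁.edge u y ⊆ X
    · simp [side, h]
    · simpa [side, h] using (hedge y hy).resolve_left h
  have hadm : (Ψ₁.toGraph cs).IsAdmissible u (visualSubgroup cs X) (visualSubgroup cs Y) side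
      (fun _ => 1) := by
    refine ⟨fun _ => one_mem _, fun _ _ _ _ _ => rfl, fun y hy => ?_⟩
    rw [conjSubgroup_one, ← apply_ite (visualSubgroup cs)]
    exact visualSubgroup_mono cs (hside y hy)
  have htree := isTreeDecomposition_visualRefine (isTreeDecomposition_of_decomposition d₁)
    hunion.symm hXY hside
  obtain ⟨Φ, hΦ, hred, hΦedge, hΦvert⟩ := htree.exists_reducesTo cs
  rw [toGraph_visualRefine] at hred
  refine h₁.maximal u _ _ _ hD hsplit side _ hadm (Φ.toGraph cs) hred ?_
  -- the vertices of the reduced refinement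
  have hX' : ∃ z, X ⊆ Φ.vert z := by
    obtain ⟨z, hz⟩ := hΦvert (some u)
    refine ⟨z, subset_trans ?_ hz⟩
    change X ⊆ if u = u then X else Ψ₁.vert u
    rw [if_pos rfl]
  have hY' : ∃ z, Y ⊆ Φ.vert z := hΦvert none
  have hv' : ∀ v, v ≠ u → ∃ z, Ψ₁.vert v ⊆ Φ.vert z := by
    intro v hv
    obtain ⟨z, hz⟩ := hΦvert (some v)
    refine ⟨z, subset_trans ?_ hz⟩
    change Ψ₁.vert v ⊆ if v = u then X else Ψ₁.vert v
    rw [if_neg hv]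
  have hR' : ∀ R : Set B, ∀ v, R ⊆ Ψ₁.vert v →
      R ⊆ Ψ₂.sideSet a b ∨ R ⊆ Ψ₂.sideSet b a → ∃ z, R ⊆ Φ.vert z := by
    intro R v hR hRab
    by_cases hvu : v = u
    · subst hvu
      rcases hsub R hR hRab with h | h
      · exact hX'.imp fun _ => h.trans
      · exact hY'.imp fun _ => h.trans
    · exact (hv' v hvu).imp fun _ => hR.trans
  refine ⟨hΦ.isDecompositionOf cs, hred.2, ?_, ?_, ?_⟩
  · intro y hy
    obtain ⟨z, k, hk, hle⟩ := h₁.weakly.compatible y hy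
    obtain ⟨v, hv⟩ := exists_subset_vert_of_le_conjSubgroup d₁ (hV y hy) hk hle
    obtain ⟨z, hz⟩ := hR' _ v hv (edge_subset_sideSet_of_compatible hV h₂ hab hy)
    refine ⟨z, 1, one_mem _, ?_⟩
    rw [conjSubgroup_one]
    exact visualSubgroup_mono cs hz
  · intro p q hpq
    obtain ⟨p', q', hpq', he⟩ := hΦedge p q hpq
    change visualSubgroup cs (Φ.edge p q) ∈ _
    rw [he]
    rcases visualRefine_edge_eq_or hpq' with h' | ⟨y, z, hyz, h'⟩
    · rw [h']
      exact hD
    · rw [h']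
      exact h₁.weakly.edge_mem _ _ hyz
  · intro A hA
    obtain ⟨v, h, hh, hAv⟩ := h₁.weakly.elliptic A hA
    by_cases hvu : v = u
    · subst hvu
      obtain ⟨z, k, hk, hAz⟩ := h₂.elliptic A hA
      obtain ⟨q, hq, w, hw, R, hRQ, hRz, hle⟩ :=
        exists_inf_conjSubgroup_le cs (Ψ₁.vert v) (Ψ₂.vert z) (h⁻¹ * k)
      have hqV : q ∈ visualSubgroup cs (Ψ.vert x) := d₁.vert_le v hq
      have hwV : w ∈ visualSubgroup cs (Ψ.vert x) := d₂.vert_le z hw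
      have hRab := subset_sideSet_of_le_conjSubgroup d₂ hab (hRQ.trans hQV)
        (mul_mem (mul_mem hqV (mul_mem (inv_mem hh) hk)) hwV) hRz
      obtain ⟨z', hz'⟩ := hR' R v hRQ hRab
      refine ⟨z', h * q⁻¹, mul_mem hh (inv_mem hqV), fun g hg => ?_⟩
      have h1 := mem_conjSubgroup.1 (hAv hg)
      have h2 := mem_conjSubgroup.1 (hAz hg)
      have h3 := hle ⟨h1, mem_conjSubgroup.2 (by
        have e : (h⁻¹ * k)⁻¹ * (h⁻¹ * g * h) * (h⁻¹ * k) = k⁻¹ * g * k := by group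
        rw [e]
        exact h2)⟩
      have h4 := conjSubgroup_mono q⁻¹ (visualSubgroup_mono cs hz') h3
      rw [mem_conjSubgroup] at h4 ⊢
      have e : (h * q⁻¹)⁻¹ * g * (h * q⁻¹) = q⁻¹⁻¹ * (h⁻¹ * g * h) * q⁻¹ := by group
      rw [e]
      exact h4
    · obtain ⟨z, hz⟩ := hv' v hvu
      exact ⟨z, h, hh, hAv.trans (conjSubgroup_mono h (visualSubgroup_mono cs hz))⟩

/-- In a reduced visual decomposition, no vertex is contained in another. -/
theorem eq_of_vert_subset_vert {V : Set B}
    (h : (Ψ₁.toGraph cs).IsDecompositionOf (visualSubgroup cs V))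
    (hred : (Ψ₁.toGraph cs).IsReduced) {u v : Ψ₁.ι} (huv : Ψ₁.vert u ⊆ Ψ₁.vert v) : u = v := by
  by_contra hne
  obtain ⟨b, hub, hvb, -⟩ := exists_adj_mem_edgeSide (isTree_of_decomposition h) hne
  refine (hred u b hub).1 (congrArg (visualSubgroup cs) (Set.Subset.antisymm
    (edge_subset_of_decomposition h hub) ?_))
  rw [← sideSet_inter_of_decomposition h hub]
  exact Set.subset_inter (Ψ₁.vert_subset_sideSet (left_mem_edgeSide _ _ _))
    (huv.trans (Ψ₁.vert_subset_sideSet hvb))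

theorem range_vert_subset [Finite B]
    (hV : ∀ y, Ψ.graph.Adj x y → Ψ.edge x y ⊆ Ψ.vert x)
    (h₁ : (Ψ.toGraph cs).IsJSJ x (Ψ₁.toGraph cs)) (h₂ : (Ψ.toGraph cs).IsJSJ x (Ψ₂.toGraph cs)) :
    Set.range Ψ₁.vert ⊆ Set.range Ψ₂.vert := by
  rintro _ ⟨u, rfl⟩
  obtain ⟨z, hz⟩ := exists_vert_subset_vert hV h₁ h₂.weakly u
  obtain ⟨v, hv⟩ := exists_vert_subset_vert hV h₂ h₁.weakly z
  have := eq_of_vert_subset_vert h₁.weakly.decomposition h₁.weakly.reduced (hz.trans hv)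
  subst this
  exact ⟨z, Set.Subset.antisymm hv hz⟩

end JSJ

end VisualGraph

end

end

end CoxeterJSJ

theorem mainTheorem5 {B : Type*} [Finite B] {W : Type*} [Group W] {M : CoxeterMatrix B}
    (cs : CoxeterSystem M W) (Ψ : CoxeterJSJ.VisualGraph B)
    (hΨ : CoxeterJSJ.IsJSJAmenable cs Ψ) (x : Ψ.ι) (Ψ₁ Ψ₂ : CoxeterJSJ.VisualGraph B)
    (h₁ : CoxeterJSJ.IsVisualJSJ cs Ψ x Ψ₁) (h₂ : CoxeterJSJ.IsVisualJSJ cs Ψ x Ψ₂) :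
    Set.range Ψ₁.vert = Set.range Ψ₂.vert := by
  have hV : ∀ y, Ψ.graph.Adj x y → Ψ.edge x y ⊆ Ψ.vert x := fun y hy =>
    (CoxeterJSJ.visualSubgroup_le_iff cs).1 (hΨ.decomposition.edge_le x y hy)
  exact Set.Subset.antisymm (CoxeterJSJ.VisualGraph.range_vert_subset hV h₁ h₂)
    (CoxeterJSJ.VisualGraph.range_vert_subset hV h₂ h₁)
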